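/- Let $k$ be an algebraically closed field of characteristic zero and fix $n\in\mathbb N$. A group-valued prestack is a functor from commutative $k$-algebras to groups. A representation of a group-valued prestack $H$ on a $k$-vector space $V$ is a morphism of group-valued prestacks $H\to GL_V$, where $GL_V(R)=GL_R(V\otimes_k R)$. Let $K$ be the group-valued prestack whose $R$-points are the continuous $R$-algebra automorphisms $\rho$ of $R[[t_1,\dots,t_n]]$ such that every $\rho(t_i)$ has zero constant term. For $c\in\mathbb N$ let $K^{(c)}$ be the group of origin-preserving $R$-algebra automorphisms of $R[[t_1,\dots,t_n]]/(t_1,\dots,t_n)^{c+1}$, a finite-dimensional quotient of $K$. Let $K^{\text{ét}}\subset K$ be the subgroup prestack whose $R$-points are the automorphisms of étale type. These are the automorphisms given by $\hat\phi\circ\hat\psi^{-1}$ on the formal completion of $\mathbb A^n_R$ along its zero section $z$, for some scheme $V'$ over $\operatorname{Spec}R$ with a section $\tau$ and étale $R$-morphisms $\phi,\psi:V'\to\mathbb A^n_R$ with $\phi\circ\tau=\psi\circ\tau=z$. **Theorem.** Let $V$ be a finite-dimensional $k$-vector space and let $\mathbf R:K^{\text{ét}}\to GL_V$ be a representation. Then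 $\mathbf R$ extends uniquely to a representation $\overline{\mathbf R}:K\to GL_V$. Moreover, there is some $c\in\mathbb N$ such that $\mathbf R$ factors through the finite-dimensional quotient $K^{(c)}$, i.e. $\mathbf R$ is the composition of $K^{\text{ét}}\hookrightarrow K\twoheadrightarrow K^{(c)}$ with a representation $\mathbf R^{(c)}:K^{(c)}\to GL_V$, and $\overline{\mathbf R}$ is the composition $K\twoheadrightarrow K^{(c)}\xrightarrow{\mathbf R^{(c)}}GL_V$. -/

import Mathlib

open CategoryTheory CategoryTheory.Limits AlgebraicGeometry TensorProduct

universe u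

noncomputable section

namespace FormalDisc

/-! ### Power series, jets, and their homomorphisms -/

/-- `R[[t₁, …, tₙ]]`, the functions on the formal `n`-disc over `R`. -/
abbrev Ser (n : ℕ) (R : Type u) [CommRing R] : Type u := MvPowerSeries (Fin n) R

/-- `R[t₁, …, tₙ] / (t₁, …, tₙ)^(c+1) = R[[t₁, …, tₙ]] / (t₁, …, tₙ)^(c+1)`, the functions on the
`c`-th infinitesimal neighbourhood of the zero section in affine `n`-space over `R`. -/
abbrev Jet (n c : ℕ) (R : Type u) [CommRing R] : Type u :=
  MvPolynomial (Fin n) R ⧸ (MvPolynomial.idealOfVars (Fin n) R) ^ (c + 1)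

/-- The truncation `R[[t]] → R[[t]] / (t)^(c+1)`. -/
def trunc (n c : ℕ) (R : Type u) [CommRing R] : Ser n R →+* Jet n c R :=
  (MvPowerSeries.truncTotalAlgHom (Fin n) R (c + 1)).toRingHom

/-- The class of `t_k` in the ring of jets. -/
def jetX (n c : ℕ) (R : Type u) [CommRing R] (k : Fin n) : Jet n c R :=
  Ideal.Quotient.mk _ (MvPolynomial.X k)

/-- Restriction of a jet to the zero section (its constant term). -/
def jetAug (n c : ℕ) (R : Type u) [CommRing R] : Jet n c R →ₐ[R] R :=
  Ideal.Quotient.liftₐ _ (MvPolynomial.aeval (fun _ => (0 : R))) (by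
    intro a ha
    have hle : MvPolynomial.idealOfVars (Fin n) R ≤
        RingHom.ker (MvPolynomial.aeval (fun _ : Fin n => (0 : R))) := by
      rw [Ideal.span_le]
      rintro _ ⟨k, rfl⟩
      simp [RingHom.mem_ker]
    exact hle (Ideal.pow_le_self (Nat.succ_ne_zero c) ha))

section
variable {n c : ℕ} {R S : Type u} [CommRing R] [CommRing S]

@[simp] lemma jetAug_X (k : Fin n) : jetAug n c R (jetX n c R k) = 0 := by
  change MvPolynomial.aeval (fun _ : Fin n => (0 : R)) (MvPolynomial.X k) = 0
  simp

lemma trunc_coe (p : MvPolynomial (Fin n) R) :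
    trunc n c R (p : Ser n R) = Ideal.Quotient.mk _ p :=
  (MvPowerSeries.truncTotalAlgHom (Fin n) R (c + 1)).commutes p

@[simp] lemma trunc_X (k : Fin n) : trunc n c R (MvPowerSeries.X k) = jetX n c R k := by
  rw [← MvPolynomial.coe_X, trunc_coe, jetX]

@[simp] lemma trunc_C (r : R) :
    trunc n c R (MvPowerSeries.C r) = algebraMap R (Jet n c R) r := by
  rw [← MvPolynomial.coe_C, trunc_coe]; rfl

lemma ser_mem_pow (N : ℕ) (p : Ser n R)
    (hp : ∀ d : Fin n →₀ ℕ, d.degree < N → MvPowerSeries.coeff d p = 0) :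
    p ∈ (Ideal.span (Set.range (MvPowerSeries.X : Fin n → Ser n R))) ^ N := by
  classical
  induction N generalizing p with
  | zero => simp
  | succ N ih =>
    have hch : ∀ d : Fin n →₀ ℕ, ∃ k : Option (Fin n), d ≠ 0 → ∃ j, k = some j ∧ d j ≠ 0 :=
      fun d => by
        by_cases hd : d = 0
        · exact ⟨none, fun h => absurd hd h⟩
        · obtain ⟨j, hj⟩ : ∃ j, d j ≠ 0 := by
            by_contra! h
            exact hd (Finsupp.ext h)
          exact ⟨some j, fun _ => ⟨j, rfl, hj⟩⟩
    choose κ hκ using hch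
    let q : Fin n → Ser n R := fun k e =>
      if κ (e + Finsupp.single k 1) = some k then
        MvPowerSeries.coeff (e + Finsupp.single k 1) p else 0
    have hq : ∀ k e, MvPowerSeries.coeff e (q k) =
      if κ (e + Finsupp.single k 1) = some k then
        MvPowerSeries.coeff (e + Finsupp.single k 1) p else 0 := fun _ _ => rfl
    have hsum : p = ∑ k, MvPowerSeries.X k * q k := by
      ext d
      rw [map_sum]
      by_cases hd : d = 0
      · subst hd
        rw [hp 0 (by simp)]
        symm
        apply Finset.sum_eq_zero
        intro k _
        simp
      · obtain ⟨j, hk, hj⟩ := hκ d hd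
        rw [Finset.sum_eq_single j]
        · obtain ⟨e, rfl⟩ : ∃ e, d = e + Finsupp.single j 1 := by
            refine ⟨d - Finsupp.single j 1, ?_⟩
            rw [tsub_add_cancel_of_le]
            rw [Finsupp.single_le_iff]
            exact Nat.one_le_iff_ne_zero.mpr hj
          rw [mul_comm, MvPowerSeries.X,
            MvPowerSeries.coeff_add_mul_monomial, hq, if_pos hk, mul_one]
        · intro k _ hkj
          by_cases hdk : d k = 0
          · rw [MvPowerSeries.X, MvPowerSeries.coeff_monomial_mul, if_neg]
            rw [Finsupp.single_le_iff]; omega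
          · obtain ⟨e, rfl⟩ : ∃ e, d = e + Finsupp.single k 1 := by
              refine ⟨d - Finsupp.single k 1, ?_⟩
              rw [tsub_add_cancel_of_le]
              rw [Finsupp.single_le_iff]
              exact Nat.one_le_iff_ne_zero.mpr hdk
            rw [mul_comm, MvPowerSeries.X, MvPowerSeries.coeff_add_mul_monomial, hq,
              if_neg (fun h => hkj (Option.some.inj (h.symm.trans hk))), zero_mul]
        · simp
    rw [hsum, pow_succ']
    refine Ideal.sum_mem _ fun k _ => Ideal.mul_mem_mul (Ideal.subset_span ⟨k, rfl⟩) (ih _ ?_)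
    intro d hd
    rw [hq]
    split_ifs
    · apply hp
      simp only [map_add, Finsupp.degree_single]
      omega
    · rfl

/-- Ring homomorphisms out of `R[[t]]` sending the `t_k` into a nilpotent ideal are determined by
their values on constants and on the `t_k`. -/
lemma ser_hom_ext {B : Type*} [CommRing B] (I : Ideal B) (N : ℕ) (hI : I ^ N = ⊥)
    (α β : Ser n R →+* B) (hC : ∀ r, α (MvPowerSeries.C r) = β (MvPowerSeries.C r))
    (hX : ∀ k, α (MvPowerSeries.X k) = β (MvPowerSeries.X k))
    (hα : ∀ k, α (MvPowerSeries.X k) ∈ I) : α = β := by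
  have hpoly : ∀ p : MvPolynomial (Fin n) R, α (p : Ser n R) = β (p : Ser n R) := by
    intro p
    have : α.comp (MvPolynomial.coeToMvPowerSeries.ringHom) =
        β.comp (MvPolynomial.coeToMvPowerSeries.ringHom) := by
      apply MvPolynomial.ringHom_ext
      · intro r; simpa using hC r
      · intro k; simpa using hX k
    exact DFunLike.congr_fun this p
  have key : ∀ γ : Ser n R →+* B, (∀ k, γ (MvPowerSeries.X k) ∈ I) → ∀ q : Ser n R,
      (∀ d : Fin n →₀ ℕ, d.degree < N → MvPowerSeries.coeff d q = 0) → γ q = 0 := by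
    intro γ hγ q hq
    have h1 : Ideal.map γ (Ideal.span (Set.range (MvPowerSeries.X : Fin n → Ser n R))) ≤ I := by
      rw [Ideal.map_span, Ideal.span_le]
      rintro _ ⟨_, ⟨k, rfl⟩, rfl⟩
      exact hγ k
    have h2 := Ideal.mem_map_of_mem γ (ser_mem_pow N q hq)
    rw [Ideal.map_pow] at h2
    have h3 := Ideal.pow_right_mono h1 N h2
    rwa [hI, Ideal.mem_bot] at h3
  ext p
  have hq : ∀ d : Fin n →₀ ℕ, d.degree < N →
      MvPowerSeries.coeff d (p - ((MvPowerSeries.truncTotal N p : MvPolynomial (Fin n) R) :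
        Ser n R)) = 0 := by
    intro d hd
    rw [map_sub, MvPolynomial.coeff_coe, MvPowerSeries.coeff_truncTotal _ hd, sub_self]
  have e1 := key α hα _ hq
  have e2 := key β (fun k => hX k ▸ hα k) _ hq
  rw [map_sub, sub_eq_zero] at e1 e2
  rw [e1, e2, hpoly]

lemma jet_hom_ext {B : Type*} [CommRing B] {α β : Jet n c R →+* B}
    (hC : ∀ r, α (algebraMap R _ r) = β (algebraMap R _ r))
    (hX : ∀ k, α (jetX n c R k) = β (jetX n c R k)) : α = β := by
  apply Ideal.Quotient.ringHom_ext
  apply MvPolynomial.ringHom_ext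
  · intro r; exact hC r
  · intro k; exact hX k

lemma jet_ker_pow : (RingHom.ker (jetAug n c R)) ^ (c + 1) = ⊥ := by
  have hle : RingHom.ker (jetAug n c R) ≤
      Ideal.map (Ideal.Quotient.mk _) (MvPolynomial.idealOfVars (Fin n) R) := by
    intro x hx
    obtain ⟨p, rfl⟩ := Ideal.Quotient.mk_surjective x
    apply Ideal.mem_map_of_mem
    rw [RingHom.mem_ker] at hx
    have hx' : MvPolynomial.aeval (fun _ : Fin n => (0 : R)) p = 0 := hx
    rw [← pow_one (MvPolynomial.idealOfVars (Fin n) R), MvPolynomial.mem_pow_idealOfVars_iff']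
    intro d hd
    have hd0 : d = 0 := by simpa [Finsupp.degree_eq_zero_iff] using hd
    subst hd0
    rw [← MvPolynomial.constantCoeff_eq]
    have := MvPolynomial.aeval_zero' (S₁ := R) p
    simpa [this] using hx'
  rw [eq_bot_iff]
  refine (Ideal.pow_right_mono hle (c + 1)).trans ?_
  rw [← Ideal.map_pow, Ideal.map_quotient_self]

/-- The substitution endomorphism `t_k ↦ s k` of the ring of jets. -/
def jetHom (s : Fin n → Jet n c R) (hs : ∀ k, jetAug n c R (s k) = 0) :
    Jet n c R →ₐ[R] Jet n c R :=
  Ideal.Quotient.liftₐ _ (MvPolynomial.aeval s) (by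
    intro a ha
    have h1 : Ideal.map (MvPolynomial.aeval s : MvPolynomial (Fin n) R →ₐ[R] Jet n c R)
        (MvPolynomial.idealOfVars (Fin n) R) ≤ RingHom.ker (jetAug n c R) := by
      rw [Ideal.map_span, Ideal.span_le]
      rintro _ ⟨_, ⟨k, rfl⟩, rfl⟩
      simpa [RingHom.mem_ker] using hs k
    have h2 := Ideal.mem_map_of_mem
      (MvPolynomial.aeval s : MvPolynomial (Fin n) R →ₐ[R] Jet n c R) ha
    rw [Ideal.map_pow] at h2
    have h3 := Ideal.pow_right_mono h1 _ h2
    rwa [jet_ker_pow, Ideal.mem_bot] at h3)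

@[simp] lemma jetHom_X (s : Fin n → Jet n c R) (hs : ∀ k, jetAug n c R (s k) = 0) (k : Fin n) :
    jetHom s hs (jetX n c R k) = s k := by
  change MvPolynomial.aeval s (MvPolynomial.X k) = s k
  simp

/-- Coefficientwise base change of jets. -/
def jetMap (n c : ℕ) (f : R →+* S) : Jet n c R →+* Jet n c S :=
  Ideal.quotientMap _ (MvPolynomial.map f) (by
    rw [← Ideal.map_le_iff_le_comap, Ideal.map_pow]
    apply Ideal.pow_right_mono
    rw [Ideal.map_span, Ideal.span_le]
    rintro _ ⟨_, ⟨k, rfl⟩, rfl⟩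
    simpa using Ideal.subset_span (Set.mem_range_self k))

@[simp] lemma jetMap_X (f : R →+* S) (k : Fin n) :
    jetMap n c f (jetX n c R k) = jetX n c S k := by
  simp [jetMap, jetX]

@[simp] lemma jetMap_algebraMap (f : R →+* S) (r : R) :
    jetMap n c f (algebraMap R _ r) = algebraMap S _ (f r) := by
  change jetMap n c f (Ideal.Quotient.mk _ (MvPolynomial.C r)) =
    Ideal.Quotient.mk _ (MvPolynomial.C (f r))
  simp [jetMap]

lemma jetAug_jetMap (f : R →+* S) (x : Jet n c R) :
    jetAug n c S (jetMap n c f x) = f (jetAug n c R x) := by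
  have : ((jetAug n c S).toRingHom.comp (jetMap n c f)) =
      f.comp (jetAug n c R).toRingHom :=
    jet_hom_ext (fun r => by simp) (fun k => by simp)
  exact DFunLike.congr_fun this x

lemma jetAug_trunc (p : Ser n R) :
    jetAug n c R (trunc n c R p) = MvPowerSeries.constantCoeff p := by
  have : (jetAug n c R).toRingHom.comp (trunc n c R) = MvPowerSeries.constantCoeff :=
    ser_hom_ext ⊥ 1 (by simp) _ _ (by simp) (by simp) (by simp)
  exact DFunLike.congr_fun this p

lemma jetMap_trunc (f : R →+* S) (p : Ser n R) :
    jetMap n c f (trunc n c R p) = trunc n c S (MvPowerSeries.map f p) := by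
  have : (jetMap n c f).comp (trunc n c R) =
      (trunc n c S).comp (MvPowerSeries.map f) :=
    ser_hom_ext _ _ jet_ker_pow _ _ (by simp) (by simp) (by simp [RingHom.mem_ker])
  exact DFunLike.congr_fun this p

lemma ser_ext_trunc {p q : Ser n R} (h : ∀ c, trunc n c R p = trunc n c R q) : p = q := by
  ext d
  have := h d.degree
  change Ideal.Quotient.mk _ (MvPowerSeries.truncTotal (d.degree + 1) p) =
    Ideal.Quotient.mk _ (MvPowerSeries.truncTotal (d.degree + 1) q) at this
  rw [Ideal.Quotient.mk_eq_mk_iff_sub_mem, MvPolynomial.mem_pow_idealOfVars_iff'] at this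
  have := this d (Nat.lt_succ_self _)
  rwa [MvPolynomial.coeff_sub, MvPowerSeries.coeff_truncTotal _ (Nat.lt_succ_self _),
    MvPowerSeries.coeff_truncTotal _ (Nat.lt_succ_self _), sub_eq_zero] at this

lemma ser_hom_ext' (α β : Ser n R →+* Ser n S)
    (hC : ∀ r, α (MvPowerSeries.C r) = β (MvPowerSeries.C r))
    (hX : ∀ k, α (MvPowerSeries.X k) = β (MvPowerSeries.X k))
    (hα : ∀ k, MvPowerSeries.constantCoeff (α (MvPowerSeries.X k)) = 0) : α = β := by
  ext1 p
  apply ser_ext_trunc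
  intro c
  have : (trunc n c S).comp α = (trunc n c S).comp β :=
    ser_hom_ext _ _ jet_ker_pow _ _ (by simp [hC]) (by simp [hX])
      (by simp [RingHom.mem_ker, jetAug_trunc, hα])
  exact DFunLike.congr_fun this p

end

/-! ### The groups of origin-preserving automorphisms -/

lemma constantCoeff_aut {n : ℕ} {R : Type u} [CommRing R] (ρ : Ser n R ≃ₐ[R] Ser n R)
    (hρ : ∀ k, MvPowerSeries.constantCoeff (ρ (MvPowerSeries.X k)) = 0) (p : Ser n R) :
    MvPowerSeries.constantCoeff (ρ p) = MvPowerSeries.constantCoeff p := by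
  have : (MvPowerSeries.constantCoeff).comp (ρ : Ser n R →+* Ser n R) =
      MvPowerSeries.constantCoeff :=
    ser_hom_ext ⊥ 1 (by simp) _ _
      (fun r => congrArg (fun q : Ser n R => MvPowerSeries.constantCoeff q) (ρ.commutes r))
      (by simp [hρ]) (by simp [hρ])
  exact DFunLike.congr_fun this p

/-- The `R`-points of `K`: the group (under composition) of `R`-algebra automorphisms `ρ` of
`R[[t₁, …, tₙ]]` for which all `ρ(t_k)` have zero constant term. Such a `ρ` maps every power of the
ideal `(t₁, …, tₙ)` into itself, so it is automatically continuous for the adic topology. -/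
def originAut (n : ℕ) (R : Type u) [CommRing R] : Subgroup (Ser n R ≃ₐ[R] Ser n R) where
  carrier := {ρ | ∀ k, MvPowerSeries.constantCoeff (ρ (MvPowerSeries.X k)) = 0}
  one_mem' := fun k => by simp
  mul_mem' := fun {ρ σ} hρ hσ k => by
    rw [AlgEquiv.mul_apply, constantCoeff_aut ρ hρ]
    exact hσ k
  inv_mem' := fun {ρ} hρ k => by
    rw [← constantCoeff_aut ρ hρ]
    change MvPowerSeries.constantCoeff (ρ (ρ.symm _)) = 0
    simp

lemma jetAug_aut {n c : ℕ} {R : Type u} [CommRing R] (σ : Jet n c R ≃ₐ[R] Jet n c R)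
    (hσ : ∀ k, jetAug n c R (σ (jetX n c R k)) = 0) (x : Jet n c R) :
    jetAug n c R (σ x) = jetAug n c R x := by
  have : (jetAug n c R).toRingHom.comp (σ : Jet n c R →+* Jet n c R) =
      (jetAug n c R).toRingHom :=
    jet_hom_ext (fun r => by simp) (fun k => by simpa using hσ k)
  exact DFunLike.congr_fun this x

/-- The `R`-points of `K^(c)`: the group of `R`-algebra automorphisms of
`R[[t₁, …, tₙ]] / (t₁, …, tₙ)^(c+1)` preserving the origin, i.e. such that the image of each `t_k`
has zero constant term. -/
def originJetAut (n c : ℕ) (R : Type u) [CommRing R] : Subgroup (Jet n c R ≃ₐ[R] Jet n c R) where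
  carrier := {σ | ∀ k, jetAug n c R (σ (jetX n c R k)) = 0}
  one_mem' := fun k => by simp
  mul_mem' := fun {ρ σ} hρ hσ k => by
    rw [AlgEquiv.mul_apply, jetAug_aut ρ hρ]
    exact hσ k
  inv_mem' := fun {ρ} hρ k => by
    rw [← jetAug_aut ρ hρ]
    change jetAug n c R (ρ (ρ.symm _)) = 0
    simp

section
variable {n c : ℕ} {R S T : Type u} [CommRing R] [CommRing S] [CommRing T]

lemma ρ_C (ρ : originAut n R) (r : R) : ρ.1 (MvPowerSeries.C r) = MvPowerSeries.C r :=
  ρ.1.commutes r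

lemma originAut_ext {ρ σ : originAut n R}
    (h : ∀ k, ρ.1 (MvPowerSeries.X k) = σ.1 (MvPowerSeries.X k)) : ρ = σ := by
  have : (ρ.1 : Ser n R →+* Ser n R) = (σ.1 : Ser n R →+* Ser n R) :=
    ser_hom_ext' _ _ (fun r => by simp [ρ_C]) (fun k => by simpa using h k)
      (fun k => by simpa using ρ.2 k)
  apply Subtype.ext
  ext1 p
  exact DFunLike.congr_fun this p

lemma originJetAut_ext {ρ σ : originJetAut n c R}
    (h : ∀ k, ρ.1 (jetX n c R k) = σ.1 (jetX n c R k)) : ρ = σ := by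
  have : (ρ.1 : Jet n c R →+* Jet n c R) = (σ.1 : Jet n c R →+* Jet n c R) :=
    jet_hom_ext (fun r => by simp) (fun k => by simpa using h k)
  apply Subtype.ext
  ext1 p
  exact DFunLike.congr_fun this p

lemma originAut_map_X (f : R →+* S) (ρ : originAut n R) (k : Fin n) :
    MvPowerSeries.constantCoeff (MvPowerSeries.map f (ρ.1 (MvPowerSeries.X k))) = 0 := by
  rw [MvPowerSeries.constantCoeff_map, ρ.2 k, map_zero]

/-- The endomorphism `t_k ↦ f(ρ(t_k))` of `S[[t]]`, where `f` is applied to the coefficients. -/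
def serHom (f : R →+* S) (ρ : originAut n R) : Ser n S →ₐ[S] Ser n S :=
  MvPowerSeries.substAlgHom
    (MvPowerSeries.hasSubst_of_constantCoeff_zero (originAut_map_X f ρ))

@[simp] lemma serHom_X (f : R →+* S) (ρ : originAut n R) (k : Fin n) :
    serHom f ρ (MvPowerSeries.X k) = MvPowerSeries.map f (ρ.1 (MvPowerSeries.X k)) :=
  MvPowerSeries.substAlgHom_X _ k

@[simp] lemma serHom_C (f : R →+* S) (ρ : originAut n R) (s : S) :
    serHom f ρ (MvPowerSeries.C s) = MvPowerSeries.C s :=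
  (serHom f ρ).commutes s

lemma serHom_map (f : R →+* S) (ρ : originAut n R) (p : Ser n R) :
    serHom f ρ (MvPowerSeries.map f p) = MvPowerSeries.map f (ρ.1 p) := by
  have : (serHom f ρ).toRingHom.comp (MvPowerSeries.map f) =
      (MvPowerSeries.map f).comp (ρ.1 : Ser n R →+* Ser n R) :=
    ser_hom_ext' _ _ (fun r => by simp [ρ_C]) (fun k => by simp)
      (fun k => by simpa using originAut_map_X f ρ k)
  exact DFunLike.congr_fun this p

lemma serHom_comp (f : R →+* S) (ρ σ : originAut n R) (h : ρ * σ = 1) :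
    (serHom f ρ).comp (serHom f σ) = AlgHom.id S _ := by
  have h' : ∀ p, ρ.1 (σ.1 p) = p := fun p => by
    have := congrArg (fun τ : originAut n R => τ.1 p) h
    simpa using this
  have : ((serHom f ρ).comp (serHom f σ)).toRingHom = RingHom.id _ :=
    ser_hom_ext' _ _ (fun r => by simp)
      (fun k => by simp [serHom_map, h'])
      (fun k => by simp [serHom_map, h'])
  ext1 p
  exact DFunLike.congr_fun this p

/-- Base change `K(R) → K(S)` along a ring homomorphism `f : R → S`: `f` is applied to the
coefficients of the power series `ρ(t_k)`. -/
def originAutMap (n : ℕ) (f : R →+* S) : originAut n R →* originAut n S where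
  toFun ρ := ⟨AlgEquiv.ofAlgHom (serHom f ρ) (serHom f ρ⁻¹)
      (serHom_comp f _ _ (mul_inv_cancel ρ)) (serHom_comp f _ _ (inv_mul_cancel ρ)), fun k => by
    simpa using originAut_map_X f ρ k⟩
  map_one' := originAut_ext fun k => by simp
  map_mul' ρ σ := originAut_ext fun k => by simp [serHom_map]

@[simp] lemma originAutMap_X (f : R →+* S) (ρ : originAut n R) (k : Fin n) :
    (originAutMap n f ρ).1 (MvPowerSeries.X k) =
      MvPowerSeries.map f (ρ.1 (MvPowerSeries.X k)) :=
  serHom_X f ρ k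

lemma originJetAut_map_X (f : R →+* S) (σ : originJetAut n c R) (k : Fin n) :
    jetAug n c S (jetMap n c f (σ.1 (jetX n c R k))) = 0 := by
  rw [jetAug_jetMap, σ.2 k, map_zero]

lemma jetHom_map (f : R →+* S) (σ : originJetAut n c R) (x : Jet n c R) :
    jetHom _ (originJetAut_map_X f σ) (jetMap n c f x) = jetMap n c f (σ.1 x) := by
  have : (jetHom _ (originJetAut_map_X f σ)).toRingHom.comp (jetMap n c f) =
      (jetMap n c f).comp (σ.1 : Jet n c R →+* Jet n c R) :=
    jet_hom_ext (fun r => by simp) (fun k => by simp)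
  exact DFunLike.congr_fun this x

lemma jetHom_map_comp (f : R →+* S) (ρ σ : originJetAut n c R) (h : ρ * σ = 1) :
    (jetHom _ (originJetAut_map_X f ρ)).comp (jetHom _ (originJetAut_map_X f σ)) =
      AlgHom.id S _ := by
  have h' : ∀ p, ρ.1 (σ.1 p) = p := fun p => by
    have := congrArg (fun τ : originJetAut n c R => τ.1 p) h
    simpa using this
  have : ((jetHom _ (originJetAut_map_X f ρ)).comp
      (jetHom _ (originJetAut_map_X f σ))).toRingHom = RingHom.id _ :=
    jet_hom_ext (fun r => by simp) (fun k => by simp [jetHom_map, h'])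
  apply AlgHom.coe_ringHom_injective
  exact this

/-- Base change `K^(c)(R) → K^(c)(S)` along a ring homomorphism. -/
def originJetAutMap (n c : ℕ) (f : R →+* S) : originJetAut n c R →* originJetAut n c S where
  toFun σ := ⟨AlgEquiv.ofAlgHom (jetHom _ (originJetAut_map_X f σ))
      (jetHom _ (originJetAut_map_X f σ⁻¹))
      (jetHom_map_comp f _ _ (mul_inv_cancel σ)) (jetHom_map_comp f _ _ (inv_mul_cancel σ)),
    fun k => by simpa using originJetAut_map_X f σ k⟩
  map_one' := originJetAut_ext fun k => by simp
  map_mul' ρ σ := originJetAut_ext fun k => by simp [jetHom_map]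

@[simp] lemma originJetAutMap_X (f : R →+* S) (σ : originJetAut n c R) (k : Fin n) :
    (originJetAutMap n c f σ).1 (jetX n c S k) = jetMap n c f (σ.1 (jetX n c R k)) :=
  jetHom_X _ (originJetAut_map_X f σ) k

lemma originAut_trunc_X (c : ℕ) (ρ : originAut n R) (k : Fin n) :
    jetAug n c R (trunc n c R (ρ.1 (MvPowerSeries.X k))) = 0 := by
  rw [jetAug_trunc]; exact ρ.2 k

lemma jetHom_trunc (c : ℕ) (ρ : originAut n R) (p : Ser n R) :
    jetHom _ (originAut_trunc_X c ρ) (trunc n c R p) = trunc n c R (ρ.1 p) := by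
  have : (jetHom _ (originAut_trunc_X c ρ)).toRingHom.comp (trunc n c R) =
      (trunc n c R).comp (ρ.1 : Ser n R →+* Ser n R) :=
    ser_hom_ext _ _ jet_ker_pow _ _ (fun r => by simp [ρ_C]) (fun k => by simp)
      (fun k => by simpa [RingHom.mem_ker] using originAut_trunc_X c ρ k)
  exact DFunLike.congr_fun this p

lemma jetHom_trunc_comp (c : ℕ) (ρ σ : originAut n R) (h : ρ * σ = 1) :
    (jetHom _ (originAut_trunc_X c ρ)).comp (jetHom _ (originAut_trunc_X c σ)) =
      AlgHom.id R _ := by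
  have h' : ∀ p, ρ.1 (σ.1 p) = p := fun p => by
    have := congrArg (fun τ : originAut n R => τ.1 p) h
    simpa using this
  have : ((jetHom _ (originAut_trunc_X c ρ)).comp
      (jetHom _ (originAut_trunc_X c σ))).toRingHom = RingHom.id _ :=
    jet_hom_ext (fun r => by simp) (fun k => by simp [jetHom_trunc, h'])
  apply AlgHom.coe_ringHom_injective
  exact this

/-- The quotient map `K(R) → K^(c)(R)`: the automorphism of `R[[t]] / (t)^(c+1)` induced by an
automorphism of `R[[t]]`. -/
def jetOfAut (n c : ℕ) (R : Type u) [CommRing R] : originAut n R →* originJetAut n c R where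
  toFun ρ := ⟨AlgEquiv.ofAlgHom (jetHom _ (originAut_trunc_X c ρ))
      (jetHom _ (originAut_trunc_X c ρ⁻¹))
      (jetHom_trunc_comp c _ _ (mul_inv_cancel ρ)) (jetHom_trunc_comp c _ _ (inv_mul_cancel ρ)),
    fun k => by simpa using originAut_trunc_X c ρ k⟩
  map_one' := originJetAut_ext fun k => by simp
  map_mul' ρ σ := originJetAut_ext fun k => by simp [jetHom_trunc]

@[simp] lemma jetOfAut_X (ρ : originAut n R) (k : Fin n) :
    (jetOfAut n c R ρ).1 (jetX n c R k) = trunc n c R (ρ.1 (MvPowerSeries.X k)) :=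
  jetHom_X _ (originAut_trunc_X c ρ) k

end

/-! ### Étale-type automorphisms -/

/-- Affine `n`-space over `Spec R`. -/
abbrev Aff (n : ℕ) (R : Type u) [CommRing R] : Scheme.{u} :=
  Spec (CommRingCat.of (MvPolynomial (Fin n) R))

/-- The projection of affine `n`-space to its base. -/
def affProj (n : ℕ) (R : Type u) [CommRing R] : Aff n R ⟶ Spec (CommRingCat.of R) :=
  Spec.map (CommRingCat.ofHom MvPolynomial.C)

/-- The zero section of affine `n`-space. -/
def affZero (n : ℕ) (R : Type u) [CommRing R] : Spec (CommRingCat.of R) ⟶ Aff n R :=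
  Spec.map (CommRingCat.ofHom MvPolynomial.constantCoeff)

/-- The `c`-th infinitesimal neighbourhood of the zero section in affine `n`-space. -/
abbrev infNbhd (n c : ℕ) (R : Type u) [CommRing R] : Scheme.{u} :=
  Spec (CommRingCat.of (Jet n c R))

/-- The inclusion of the zero section in its `c`-th infinitesimal neighbourhood. -/
def infZero (n c : ℕ) (R : Type u) [CommRing R] : Spec (CommRingCat.of R) ⟶ infNbhd n c R :=
  Spec.map (CommRingCat.ofHom (jetAug n c R).toRingHom)

/-- The inclusion of the `c`-th infinitesimal neighbourhood of the zero section. -/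
def infIncl (n c : ℕ) (R : Type u) [CommRing R] : infNbhd n c R ⟶ Aff n R :=
  Spec.map (CommRingCat.ofHom (Ideal.Quotient.mk _))

/-- The automorphism of the `c`-th infinitesimal neighbourhood of the zero section whose action on
functions is a given `σ ∈ K^(c)(R)`. -/
def infAut {n c : ℕ} {R : Type u} [CommRing R] (σ : originJetAut n c R) :
    infNbhd n c R ⟶ infNbhd n c R :=
  Spec.map (CommRingCat.ofHom (σ.1 : Jet n c R →+* Jet n c R))

/-- A strict common étale neighbourhood of the trivial pointed `n`-dimensional family
`(𝔸ⁿ_R → Spec R, zero section)` with itself: a scheme `V` over `Spec R` with a section `τ` and two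
étale maps `φ, ψ : V → 𝔸ⁿ_R` over `Spec R`, both carrying `τ` to the zero section. Here `V` is
smooth of relative dimension `n` over `Spec R` because it is étale over `𝔸ⁿ_R`. -/
structure EtaleNbhd (n : ℕ) (R : Type u) [CommRing R] where
  V : Scheme.{u}
  π : V ⟶ Spec (CommRingCat.of R)
  τ : Spec (CommRingCat.of R) ⟶ V
  φ : V ⟶ Aff n R
  ψ : V ⟶ Aff n R
  section_τ : τ ≫ π = 𝟙 _
  etale_φ : Etale φ
  etale_ψ : Etale ψ
  φ_proj : φ ≫ affProj n R = π
  ψ_proj : ψ ≫ affProj n R = π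
  τ_φ : τ ≫ φ = affZero n R
  τ_ψ : τ ≫ ψ = affZero n R

/-- `E.Induces ρ`: the automorphism `φ̂ ∘ ψ̂⁻¹` of the formal completion of `𝔸ⁿ_R` along the zero
section is the one whose action on functions is `ρ`.

As `ψ` is étale, it identifies the `c`-th infinitesimal neighbourhood of `τ` in `V` with that of
the zero section in `𝔸ⁿ_R`. The morphism `ι` is the inverse of this identification, followed by the
inclusion in `V`: it is the unique lift along `ψ` of the inclusion of the infinitesimal
neighbourhood that extends the section `τ`. -/
def EtaleNbhd.Induces {n : ℕ} {R : Type u} [CommRing R] (E : EtaleNbhd n R)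
    (ρ : originAut n R) : Prop :=
  ∀ c : ℕ, ∃ ι : infNbhd n c R ⟶ E.V,
    infZero n c R ≫ ι = E.τ ∧
    ι ≫ E.ψ = infIncl n c R ∧
    ι ≫ E.φ = infAut (jetOfAut n c R ρ) ≫ infIncl n c R

section
variable {n c : ℕ} {R S : Type u} [CommRing R] [CommRing S]

lemma infAut_mul (ρ σ : originJetAut n c R) : infAut (ρ * σ) = infAut ρ ≫ infAut σ := by
  simp only [infAut, ← Spec.map_comp]
  rfl

lemma infAut_one : infAut (1 : originJetAut n c R) = 𝟙 _ := by
  rw [← Spec.map_id]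
  rfl

lemma infZero_infAut (σ : originJetAut n c R) : infZero n c R ≫ infAut σ = infZero n c R := by
  simp only [infAut, infZero, ← Spec.map_comp]
  congr 1
  exact CommRingCat.hom_ext (RingHom.ext fun x => jetAug_aut σ.1 σ.2 x)

lemma infZero_infIncl : infZero n c R ≫ infIncl n c R = affZero n R := by
  simp only [infIncl, infZero, affZero, ← Spec.map_comp]
  congr 1
  rw [← CommRingCat.ofHom_comp]
  congr 1
  apply MvPolynomial.ringHom_ext
  · intro r
    change jetAug n c R (algebraMap R _ r) = _
    simp
  · intro k
    change jetAug n c R (jetX n c R k) = _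
    simp

lemma affZero_affProj : affZero n R ≫ affProj n R = 𝟙 _ := by
  rw [affZero, affProj, ← Spec.map_comp, ← CommRingCat.ofHom_comp,
    MvPolynomial.constantCoeff_comp_C, ← Spec.map_id]
  rfl

lemma exists_induces_one : ∃ E : EtaleNbhd n R, E.Induces 1 :=
  ⟨{ V := Aff n R
     π := affProj n R
     τ := affZero n R
     φ := 𝟙 _
     ψ := 𝟙 _
     section_τ := affZero_affProj
     etale_φ := inferInstance
     etale_ψ := inferInstance
     φ_proj := by simp
     ψ_proj := by simp
     τ_φ := by simp
     τ_ψ := by simp }, fun c =>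
    ⟨infIncl n c R, infZero_infIncl, by simp, by simp [infAut_one]⟩⟩

lemma exists_induces_inv {ρ : originAut n R} (E : EtaleNbhd n R) (h : E.Induces ρ) :
    ∃ E' : EtaleNbhd n R, E'.Induces ρ⁻¹ :=
  ⟨{ V := E.V
     π := E.π
     τ := E.τ
     φ := E.ψ
     ψ := E.φ
     section_τ := E.section_τ
     etale_φ := E.etale_ψ
     etale_ψ := E.etale_φ
     φ_proj := E.ψ_proj
     ψ_proj := E.φ_proj
     τ_φ := E.τ_ψ
     τ_ψ := E.τ_φ }, fun c => by
    obtain ⟨ι, h1, h2, h3⟩ := h c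
    refine ⟨infAut (jetOfAut n c R ρ⁻¹) ≫ ι, ?_, ?_, ?_⟩
    · rw [← Category.assoc, infZero_infAut, h1]
    · change (_ ≫ ι) ≫ E.φ = _
      rw [Category.assoc, h3, ← Category.assoc, ← infAut_mul, ← map_mul, inv_mul_cancel, map_one,
        infAut_one, Category.id_comp]
    · change (_ ≫ ι) ≫ E.ψ = _
      rw [Category.assoc, h2]⟩

lemma exists_induces_mul {ρ σ : originAut n R} (E : EtaleNbhd n R) (hE : E.Induces ρ)
    (F : EtaleNbhd n R) (hF : F.Induces σ) : ∃ E' : EtaleNbhd n R, E'.Induces (ρ * σ) := by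
  have := E.etale_φ
  have := E.etale_ψ
  have := F.etale_φ
  have := F.etale_ψ
  refine ⟨{ V := pullback F.ψ E.φ
            π := pullback.fst _ _ ≫ F.π
            τ := pullback.lift F.τ E.τ (by rw [F.τ_ψ, E.τ_φ])
            φ := pullback.fst _ _ ≫ F.φ
            ψ := pullback.snd _ _ ≫ E.ψ
            section_τ := by rw [pullback.lift_fst_assoc, F.section_τ]
            etale_φ := inferInstance
            etale_ψ := inferInstance
            φ_proj := by rw [Category.assoc, F.φ_proj]
            ψ_proj := by
              rw [Category.assoc, E.ψ_proj, ← E.φ_proj, ← F.ψ_proj, ← Category.assoc,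
                ← Category.assoc, pullback.condition]
            τ_φ := by rw [pullback.lift_fst_assoc, F.τ_φ]
            τ_ψ := by rw [pullback.lift_snd_assoc, E.τ_ψ] }, fun c => ?_⟩
  obtain ⟨ι, h1, h2, h3⟩ := hE c
  obtain ⟨κ, k1, k2, k3⟩ := hF c
  refine ⟨pullback.lift (infAut (jetOfAut n c R ρ) ≫ κ) ι (by rw [Category.assoc, k2, h3]),
    ?_, ?_, ?_⟩
  · apply pullback.hom_ext
    · simp only [Category.assoc, pullback.lift_fst]
      rw [← Category.assoc, infZero_infAut, k1]
    · simp only [Category.assoc, pullback.lift_snd]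
      exact h1
  · rw [pullback.lift_snd_assoc, h2]
  · rw [pullback.lift_fst_assoc, Category.assoc, k3, map_mul, infAut_mul, Category.assoc]

/-- The map of affine spaces `𝔸ⁿ_S → 𝔸ⁿ_R` induced by `f : R → S`. -/
def affMap (n : ℕ) (f : R →+* S) : Aff n S ⟶ Aff n R :=
  Spec.map (CommRingCat.ofHom (MvPolynomial.map f))

lemma isPullback_affMap (f : R →+* S) :
    IsPullback (affMap n f) (affProj n S) (affProj n R) (Spec.map (CommRingCat.ofHom f)) := by
  let := f.toAlgebra
  let : Algebra (MvPolynomial (Fin n) R) (MvPolynomial (Fin n) S) := MvPolynomial.algebraMvPolynomial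
  apply isPullback_SpecMap_of_isPushout
  exact CommRingCat.isPushout_of_isPushout R (MvPolynomial (Fin n) R) S (MvPolynomial (Fin n) S)

lemma exists_induces_map (f : R →+* S) {ρ : originAut n R} (E : EtaleNbhd n R)
    (h : E.Induces ρ) : ∃ E' : EtaleNbhd n S, E'.Induces (originAutMap n f ρ) := by
  have := E.etale_φ
  have := E.etale_ψ
  let g := Spec.map (CommRingCat.ofHom f)
  have key : ∀ χ : E.V ⟶ Aff n R, Etale χ → χ ≫ affProj n R = E.π →
      ∃ χ' : pullback E.π g ⟶ Aff n S, Etale χ' ∧ χ' ≫ affProj n S = pullback.snd _ _ ∧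
        χ' ≫ affMap n f = pullback.fst _ _ ≫ χ := by
    intro χ hχ hp
    refine ⟨(isPullback_affMap f).lift (pullback.fst _ _ ≫ χ) (pullback.snd _ _) ?_, ?_, ?_, ?_⟩
    · rw [Category.assoc, hp, pullback.condition]
    · have sq : IsPullback (pullback.fst E.π g)
          ((isPullback_affMap f).lift (pullback.fst E.π g ≫ χ) (pullback.snd _ _)
            (by rw [Category.assoc, hp, pullback.condition])) χ (affMap n f) := by
        apply IsPullback.of_bot _ (by simp) (isPullback_affMap f)
        simpa [hp] using IsPullback.of_hasPullback E.π g
      exact MorphismProperty.of_isPullback sq hχ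
    · simp
    · simp
  obtain ⟨φ', eφ, pφ, mφ⟩ := key E.φ E.etale_φ E.φ_proj
  obtain ⟨ψ', eψ, pψ, mψ⟩ := key E.ψ E.etale_ψ E.ψ_proj
  have zg : affZero n S ≫ affMap n f = g ≫ affZero n R := by
    simp only [affZero, affMap, g, ← Spec.map_comp, ← CommRingCat.ofHom_comp]
    congr 2
  have zero : ∀ (χ : E.V ⟶ Aff n R) (χ' : pullback E.π g ⟶ Aff n S), E.τ ≫ χ = affZero n R →
      χ' ≫ affProj n S = pullback.snd _ _ → χ' ≫ affMap n f = pullback.fst _ _ ≫ χ →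
      pullback.lift (g ≫ E.τ) (𝟙 _) (by simp [E.section_τ]) ≫ χ' = affZero n S := by
    intro χ χ' h1 h2 h3
    apply (isPullback_affMap f).hom_ext
    · rw [Category.assoc, h3, zg, ← Category.assoc, pullback.lift_fst, Category.assoc, h1]
    · rw [Category.assoc, h2, pullback.lift_snd, affZero_affProj]
  refine ⟨{ V := pullback E.π g
            π := pullback.snd _ _
            τ := pullback.lift (g ≫ E.τ) (𝟙 _) (by simp [E.section_τ])
            φ := φ'
            ψ := ψ'
            section_τ := by rw [pullback.lift_snd]
            etale_φ := eφ
            etale_ψ := eψ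
            φ_proj := pφ
            ψ_proj := pψ
            τ_φ := zero _ _ E.τ_φ pφ mφ
            τ_ψ := zero _ _ E.τ_ψ pψ mψ }, fun c => ?_⟩
  obtain ⟨ι, h1, h2, h3⟩ := h c
  let j : infNbhd n c S ⟶ infNbhd n c R := Spec.map (CommRingCat.ofHom (jetMap n c f))
  have jincl : j ≫ infIncl n c R = infIncl n c S ≫ affMap n f := by
    simp only [j, infIncl, affMap, ← Spec.map_comp, ← CommRingCat.ofHom_comp]
    congr 2
  have jbase : (j ≫ ι) ≫ E.π = (infIncl n c S ≫ affProj n S) ≫ g := by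
    rw [← E.ψ_proj, Category.assoc, ← Category.assoc ι, h2, ← Category.assoc, jincl,
      Category.assoc, (isPullback_affMap f).w, Category.assoc]
  have jaut : j ≫ infAut (jetOfAut n c R ρ) =
      infAut (jetOfAut n c S (originAutMap n f ρ)) ≫ j := by
    simp only [j, infAut, ← Spec.map_comp, ← CommRingCat.ofHom_comp]
    congr 2
    apply jet_hom_ext
    · intro r; simp
    · intro k
      simp [jetMap_trunc]
  have autbase : ∀ σ : originJetAut n c S,
      infAut σ ≫ infIncl n c S ≫ affProj n S = infIncl n c S ≫ affProj n S := by
    intro σ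
    simp only [infAut, infIncl, affProj, ← Spec.map_comp, ← CommRingCat.ofHom_comp]
    congr 2
    ext r
    exact σ.1.commutes r
  refine ⟨pullback.lift (j ≫ ι) (infIncl n c S ≫ affProj n S) jbase, ?_, ?_, ?_⟩
  · apply pullback.hom_ext
    · simp only [Category.assoc, pullback.lift_fst]
      rw [← h1, ← Category.assoc, ← Category.assoc]
      congr 1
      simp only [j, infZero, g, ← Spec.map_comp, ← CommRingCat.ofHom_comp]
      congr 1
      exact CommRingCat.hom_ext (RingHom.ext fun x => jetAug_jetMap f x)
    · simp only [Category.assoc, pullback.lift_snd]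
      rw [← Category.assoc, infZero_infIncl, affZero_affProj]
  · apply (isPullback_affMap f).hom_ext
    · rw [Category.assoc, mψ, ← Category.assoc, pullback.lift_fst, Category.assoc, h2, jincl]
    · rw [Category.assoc, pψ, pullback.lift_snd]
  · apply (isPullback_affMap f).hom_ext
    · rw [Category.assoc, mφ, ← Category.assoc, pullback.lift_fst, Category.assoc, h3,
        ← Category.assoc, jaut, Category.assoc, jincl, Category.assoc]
    · rw [Category.assoc, pφ, pullback.lift_snd, Category.assoc, autbase]

end

/-- The `R`-points of `K^et`: the subgroup of `K(R)` of automorphisms of étale type, i.e. those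
induced by a strict common étale neighbourhood. -/
def etaleAut (n : ℕ) (R : Type u) [CommRing R] : Subgroup (originAut n R) where
  carrier := {ρ | ∃ E : EtaleNbhd n R, E.Induces ρ}
  one_mem' := exists_induces_one
  mul_mem' := fun ⟨E, hE⟩ ⟨F, hF⟩ => exists_induces_mul E hE F hF
  inv_mem' := fun ⟨E, hE⟩ => exists_induces_inv E hE

/-- Base change `K^et(R) → K^et(S)`: the restriction of `K(R) → K(S)`. -/
def etaleAutMap (n : ℕ) {R S : Type u} [CommRing R] [CommRing S] (f : R →+* S) :
    etaleAut n R →* etaleAut n S :=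
  ((originAutMap n f).comp (etaleAut n R).subtype).codRestrict (etaleAut n S)
    (fun ρ => by obtain ⟨E, hE⟩ := ρ.2; exact exists_induces_map f E hE)

section
variable (n c : ℕ) {R S T : Type u} [CommRing R] [CommRing S] [CommRing T]

lemma originAutMap_id : originAutMap n (RingHom.id R) = MonoidHom.id _ :=
  MonoidHom.ext fun ρ => originAut_ext fun i => by
    rw [originAutMap_X, MvPowerSeries.map_id]; rfl

lemma originAutMap_comp (f : R →+* S) (g : S →+* T) :
    originAutMap n (g.comp f) = (originAutMap n g).comp (originAutMap n f) :=
  MonoidHom.ext fun ρ => originAut_ext fun i => by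
    rw [MonoidHom.comp_apply, originAutMap_X, originAutMap_X, originAutMap_X,
      MvPowerSeries.map_comp]; rfl

lemma originJetAutMap_id : originJetAutMap n c (RingHom.id R) = MonoidHom.id _ :=
  MonoidHom.ext fun ρ => originJetAut_ext fun i => by
    have : jetMap n c (RingHom.id R) = RingHom.id _ :=
      jet_hom_ext (fun r => by simp) (fun k => by simp)
    rw [originJetAutMap_X, this]; rfl

lemma originJetAutMap_comp (f : R →+* S) (g : S →+* T) :
    originJetAutMap n c (g.comp f) = (originJetAutMap n c g).comp (originJetAutMap n c f) :=
  MonoidHom.ext fun ρ => originJetAut_ext fun i => by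
    have : jetMap n c (g.comp f) = (jetMap n c g).comp (jetMap n c f) :=
      jet_hom_ext (fun r => by simp) (fun k => by simp)
    rw [MonoidHom.comp_apply, originJetAutMap_X, originJetAutMap_X, originJetAutMap_X, this]; rfl

lemma jetOfAut_originAutMap (f : R →+* S) :
    (jetOfAut n c S).comp (originAutMap n f) = (originJetAutMap n c f).comp (jetOfAut n c R) :=
  MonoidHom.ext fun ρ => originJetAut_ext fun i => by
    rw [MonoidHom.comp_apply, MonoidHom.comp_apply, jetOfAut_X, originAutMap_X,
      originJetAutMap_X, jetOfAut_X, jetMap_trunc]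

end

/-! ### Group-valued prestacks and representations -/

section
variable (k : Type u) [Field k]

/-- A group-valued prestack over `k`: a contravariant functor from affine `k`-schemes, that is a
covariant functor from commutative `k`-algebras, to groups. -/
abbrev GrpPreStk : Type (u + 1) := CommAlgCat.{u} k ⥤ GrpCat.{u}

/-- The pro-algebraic group `K` of automorphisms of the formal `n`-disc fixing the origin. -/
def K (n : ℕ) : GrpPreStk k where
  obj R := GrpCat.of (originAut n R)
  map f := GrpCat.ofHom (originAutMap n f.hom.toRingHom)
  map_id _ := GrpCat.hom_ext (originAutMap_id n)
  map_comp f g := GrpCat.hom_ext (originAutMap_comp n f.hom.toRingHom g.hom.toRingHom)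

/-- The finite-dimensional quotient `K^(c)` of `K`. -/
def Kc (n c : ℕ) : GrpPreStk k where
  obj R := GrpCat.of (originJetAut n c R)
  map f := GrpCat.ofHom (originJetAutMap n c f.hom.toRingHom)
  map_id _ := GrpCat.hom_ext (originJetAutMap_id n c)
  map_comp f g := GrpCat.hom_ext (originJetAutMap_comp n c f.hom.toRingHom g.hom.toRingHom)

/-- The group-valued prestack `K^et` of étale-type automorphisms fixing the origin. -/
def Ket (n : ℕ) : GrpPreStk k where
  obj R := GrpCat.of (etaleAut n R)
  map f := GrpCat.ofHom (etaleAutMap n f.hom.toRingHom)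
  map_id _ := GrpCat.hom_ext (MonoidHom.ext fun ρ =>
    Subtype.ext (DFunLike.congr_fun (originAutMap_id n) ρ.1))
  map_comp f g := GrpCat.hom_ext (MonoidHom.ext fun ρ => Subtype.ext
    (DFunLike.congr_fun (originAutMap_comp n f.hom.toRingHom g.hom.toRingHom) ρ.1))

/-- The inclusion `K^et ↪ K`. -/
def KetToK (n : ℕ) : Ket k n ⟶ K k n where
  app R := GrpCat.ofHom (etaleAut n R).subtype
  naturality _ _ _ := rfl

/-- The quotient map `K ↠ K^(c)`. -/
def KToKc (n c : ℕ) : K k n ⟶ Kc k n c where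
  app R := GrpCat.ofHom (jetOfAut n c R)
  naturality _ _ f := GrpCat.hom_ext (jetOfAut_originAutMap n c f.hom.toRingHom)

variable (V : Type u) [AddCommGroup V] [Module k V]

/-- Base change `R ⊗ V → S ⊗ V`, `r ⊗ v ↦ f r ⊗ v`. -/
def scalarMap {R S : CommAlgCat.{u} k} (f : R ⟶ S) : R ⊗[k] V →ₗ[k] S ⊗[k] V :=
  f.hom.toLinearMap.rTensor V

variable {k}

/-- The `S`-linear extension `s ⊗ v ↦ s • f(g(1 ⊗ v))` of an `R`-linear endomorphism `g` of
`R ⊗ V` along `f : R → S`. -/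
def endMap {R S : CommAlgCat.{u} k} (f : R ⟶ S) (g : Module.End R (R ⊗[k] V)) :
    Module.End S (S ⊗[k] V) :=
  TensorProduct.AlgebraTensorModule.lift
    (LinearMap.toSpanSingleton S (V →ₗ[k] S ⊗[k] V)
      (scalarMap k V f ∘ₗ g.restrictScalars k ∘ₗ TensorProduct.mk k R V 1))

variable {V}

lemma endMap_tmul {R S : CommAlgCat.{u} k} (f : R ⟶ S) (g : Module.End R (R ⊗[k] V))
    (s : S) (v : V) : endMap V f g (s ⊗ₜ v) = s • scalarMap k V f (g (1 ⊗ₜ v)) := by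
  simp [endMap]

lemma scalarMap_tmul {R S : CommAlgCat.{u} k} (f : R ⟶ S) (r : R) (v : V) :
    scalarMap k V f (r ⊗ₜ v) = f.hom r ⊗ₜ v := by
  simp [scalarMap]

lemma scalarMap_smul {R S : CommAlgCat.{u} k} (f : R ⟶ S) (r : R) (x : R ⊗[k] V) :
    scalarMap k V f (r • x) = f.hom r • scalarMap k V f x := by
  induction x with
  | zero => simp
  | add x y hx hy => simp only [smul_add, map_add, hx, hy]
  | tmul a v => simp [scalarMap_tmul, TensorProduct.smul_tmul']

lemma endMap_scalarMap {R S : CommAlgCat.{u} k} (f : R ⟶ S) (g : Module.End R (R ⊗[k] V))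
    (x : R ⊗[k] V) : endMap V f g (scalarMap k V f x) = scalarMap k V f (g x) := by
  induction x with
  | zero => simp
  | add x y hx hy => simp only [map_add, hx, hy]
  | tmul a v =>
    rw [scalarMap_tmul, endMap_tmul, ← scalarMap_smul, ← map_smul, TensorProduct.smul_tmul',
      smul_eq_mul, mul_one]

lemma end_ext {S : CommAlgCat.{u} k} {g h : Module.End S (S ⊗[k] V)}
    (H : ∀ v : V, g (1 ⊗ₜ v) = h (1 ⊗ₜ v)) : g = h := by
  ext v
  exact H v

variable (V)

/-- Base change of endomorphisms as a monoid homomorphism. -/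
def endMapHom {R S : CommAlgCat.{u} k} (f : R ⟶ S) :
    Module.End R (R ⊗[k] V) →* Module.End S (S ⊗[k] V) where
  toFun := endMap V f
  map_one' := end_ext fun v => by simp [endMap_tmul, scalarMap_tmul]
  map_mul' g h := end_ext fun v => by
    rw [Module.End.mul_apply, endMap_tmul, endMap_tmul, one_smul, one_smul, endMap_scalarMap,
      Module.End.mul_apply]

/-- The group-valued prestack `GL_V`, with `GL_V(R) = GL(R ⊗ V)` and base change of
automorphisms. -/
def GLV : GrpPreStk k where
  obj R := GrpCat.of (LinearMap.GeneralLinearGroup R (R ⊗[k] V))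
  map f := GrpCat.ofHom (Units.map (endMapHom V f))
  map_id R := GrpCat.hom_ext (MonoidHom.ext fun g => Units.ext (end_ext fun v => by
    change endMap V (𝟙 R) g.1 (1 ⊗ₜ v) = g.1 (1 ⊗ₜ v)
    simp [endMap_tmul, scalarMap]))
  map_comp {R S T} f g := GrpCat.hom_ext (MonoidHom.ext fun h => Units.ext (end_ext fun v => by
    change endMap V (f ≫ g) h.1 (1 ⊗ₜ v) = endMap V g (endMap V f h.1) (1 ⊗ₜ v)
    rw [endMap_tmul, endMap_tmul, endMap_tmul, one_smul, one_smul, one_smul]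
    simp [scalarMap, LinearMap.rTensor_comp]))

variable {V}

/-- A representation of a group-valued prestack `H` on `V`: a morphism of group-valued prestacks
`H → GL_V`. -/
abbrev Representation (H : GrpPreStk k) (V : Type u) [AddCommGroup V] [Module k V] : Type (u + 1) :=
  H ⟶ GLV (k := k) V

end

end FormalDisc

end

/-!
The scaling `t ↦ λ t` of the formal disc contracts the automorphisms tangent to the identity, and
this forces a finite-dimensional representation to see only finitely many Taylor coefficients.

Let `ρ` be an automorphism over `R` with `ρ ≡ id` modulo `(t)^(c+1)`, where `c ≥ 1`. The formula
`λ⁻¹ ρ(λ t)` has coefficients in `R[λ]` and defines an automorphism over `R[λ]` (`IsDilation`). It is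
`ρ` at `λ = 1`, it is the identity modulo `λ^c`, and over `R[λ, λ⁻¹]` it is the conjugate of `ρ` by
the scaling. A representation on `V` therefore sends it to a matrix over `R[λ]` which is `1` modulo
`λ^c`, but whose degree is bounded in terms of the matrices of the scaling over `k[λ, λ⁻¹]` alone.
If `c` exceeds that bound, the matrix is `1`, and so is its value at `λ = 1`, the action of `ρ`
(`app_eq_one_of_family`). The bound is the same for a representation of `K^et` and for all its
extensions to `K` (`exists_order_bound`).

For `K^et` one has to know that `λ⁻¹ ρ(λ t)` is again of étale type. Zariski locally on `R`, which
suffices for the above, `ρ` comes from an affine étale neighbourhood `Spec B` with coordinates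
`ψ_j`, on which it is given by functions `φ_i`. Near the section the `ψ_j` generate its ideal, so
that `φ_i = ∑ a_ij ψ_j`. On the base change of `Spec B` along `t ↦ λ t`, which is étale over
`𝔸ⁿ × 𝔸¹`, the functions `∑ a_ij t_j` represent `λ⁻¹ φ_i`; this is deformation to the normal cone
(`IsDilation.mem_etaleAut`). They define an étale map near the section by the Jacobian criterion
(`exists_etale_localization`), since the matrix `a_ij` is invertible there.

By the same criterion, polynomial lifts of jets of automorphisms are of étale type, so that
`K^et → K^(c)` is surjective for `c ≥ 1` (`exists_etaleAut_jetOfAut_eq`). The representation thus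
descends to `K^(c)`, and each point of `K` differs from one of `K^et` by an element on which
all extensions are trivial, which gives uniqueness.
-/

noncomputable section

namespace FormalDisc

/-! ### Formal inverse functions -/

section
variable {n : ℕ} {R : Type u} [CommRing R]

/-- The ideal `(t₁, …, tₙ)` of `R[[t₁, …, tₙ]]`. -/
def serIdeal (n : ℕ) (R : Type u) [CommRing R] : Ideal (Ser n R) :=
  Ideal.span (Set.range (MvPowerSeries.X : Fin n → Ser n R))

lemma trunc_eq_zero_of_mem {c : ℕ} {p : Ser n R} (hp : p ∈ serIdeal n R ^ (c + 1)) :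
    trunc n c R p = 0 := by
  have h1 : Ideal.map (trunc n c R) (serIdeal n R) ≤ RingHom.ker (jetAug n c R) := by
    rw [serIdeal, Ideal.map_span, Ideal.span_le]
    rintro _ ⟨_, ⟨k, rfl⟩, rfl⟩
    simp [RingHom.mem_ker]
  have h2 := Ideal.mem_map_of_mem (trunc n c R) hp
  rw [Ideal.map_pow] at h2
  have h3 := Ideal.pow_right_mono h1 (c + 1) h2
  rwa [jet_ker_pow, Ideal.mem_bot] at h3

lemma trunc_eq_zero_iff_coeff {c : ℕ} {p : Ser n R} :
    trunc n c R p = 0 ↔ ∀ d : Fin n →₀ ℕ, d.degree < c + 1 → MvPowerSeries.coeff d p = 0 := by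
  constructor
  · intro h d hd
    change Ideal.Quotient.mk _ (MvPowerSeries.truncTotal (c + 1) p) = 0 at h
    rw [Ideal.Quotient.eq_zero_iff_mem, MvPolynomial.mem_pow_idealOfVars_iff'] at h
    have := h d hd
    rwa [MvPowerSeries.coeff_truncTotal _ hd] at this
  · intro h
    exact trunc_eq_zero_of_mem (ser_mem_pow _ _ h)

lemma trunc_eq_zero_iff_mem {c : ℕ} {p : Ser n R} :
    trunc n c R p = 0 ↔ p ∈ serIdeal n R ^ (c + 1) :=
  ⟨fun h => ser_mem_pow _ _ (trunc_eq_zero_iff_coeff.1 h), trunc_eq_zero_of_mem⟩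

lemma mem_serIdeal_pow_iff {m : ℕ} {p : Ser n R} :
    p ∈ serIdeal n R ^ m ↔ ∀ d : Fin n →₀ ℕ, d.degree < m → MvPowerSeries.coeff d p = 0 := by
  cases m with
  | zero => simp
  | succ c => rw [← trunc_eq_zero_iff_mem, trunc_eq_zero_iff_coeff]

lemma mem_serIdeal_iff {p : Ser n R} :
    p ∈ serIdeal n R ↔ MvPowerSeries.constantCoeff p = 0 := by
  rw [← pow_one (serIdeal n R), mem_serIdeal_pow_iff]
  refine ⟨fun h => by simpa using h 0 (by simp), fun h d hd => ?_⟩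
  obtain rfl : d = 0 := by simpa [Finsupp.degree_eq_zero_iff] using hd
  simpa using h

/-- An endomorphism of `R[[t]]` congruent to the identity modulo `(t)²` moves every element of
`(t)^m` by an element of `(t)^(m+1)`. -/
lemma sub_mem_serIdeal_pow_succ (α : Ser n R →ₐ[R] Ser n R)
    (hα : ∀ k, α (MvPowerSeries.X k) - MvPowerSeries.X k ∈ serIdeal n R ^ 2)
    (m : ℕ) {p : Ser n R} (hp : p ∈ serIdeal n R ^ m) : α p - p ∈ serIdeal n R ^ (m + 1) := by
  set I := serIdeal n R with hI
  have hX : ∀ k, (MvPowerSeries.X k : Ser n R) ∈ I := fun k => Ideal.subset_span ⟨k, rfl⟩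
  have hαX : ∀ k, α (MvPowerSeries.X k) ∈ I := fun k => by
    have := I.add_mem (Ideal.pow_le_self two_ne_zero (hα k)) (hX k)
    rwa [sub_add_cancel] at this
  have h0 : ∀ p : Ser n R, α p - p ∈ I := by
    intro p
    have : (MvPowerSeries.constantCoeff).comp (α : Ser n R →+* Ser n R) =
        MvPowerSeries.constantCoeff :=
      ser_hom_ext ⊥ 1 (by simp) _ _
        (fun r => congrArg (fun q : Ser n R => MvPowerSeries.constantCoeff q) (α.commutes r))
        (fun k => by simpa using mem_serIdeal_iff.1 (hαX k))
        (fun k => by simpa using mem_serIdeal_iff.1 (hαX k))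
    rw [hI, mem_serIdeal_iff, map_sub, sub_eq_zero]
    exact DFunLike.congr_fun this p
  have h1 : ∀ p ∈ I, α p - p ∈ I ^ 2 := by
    intro p hp
    refine Submodule.span_induction ?_ ?_ ?_ ?_ hp
    · rintro _ ⟨k, rfl⟩
      exact hα k
    · simp
    · intro x y _ _ hx hy
      rw [map_add, add_sub_add_comm]
      exact (I ^ 2).add_mem hx hy
    · intro a x hx' hx
      have : α (a • x) - a • x = α a * (α x - x) + (α a - a) * x := by
        rw [smul_eq_mul, map_mul]; ring
      rw [this]
      refine (I ^ 2).add_mem (Ideal.mul_mem_left _ _ hx) ?_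
      rw [pow_two]
      exact Ideal.mul_mem_mul (h0 a) hx'
  induction m generalizing p with
  | zero => simpa using h0 p
  | succ m ih =>
    rw [pow_succ'] at hp
    refine Submodule.mul_induction_on hp ?_ ?_
    · intro x hx y hy
      have : α (x * y) - x * y = (α x - x) * α y + x * (α y - y) := by
        rw [map_mul]; ring
      rw [this]
      have hy' : α y ∈ I ^ m := by
        have := (I ^ m).add_mem (Ideal.pow_le_pow_right m.le_succ (ih hy)) hy
        rwa [sub_add_cancel] at this
      refine (I ^ (m + 1 + 1)).add_mem ?_ ?_
      · rw [show m + 1 + 1 = 2 + m by ring, pow_add]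
        exact Ideal.mul_mem_mul (h1 x hx) hy'
      · rw [pow_succ' I (m + 1)]
        exact Ideal.mul_mem_mul hx (ih hy)
    · intro x y hx hy
      rw [map_add, add_sub_add_comm]
      exact (I ^ _).add_mem hx hy

/-- The inverse is the geometric series `∑ (1 - α)^k`, which converges coefficientwise. -/
lemma bijective_of_sub_mem (α : Ser n R →ₐ[R] Ser n R)
    (hα : ∀ k, α (MvPowerSeries.X k) - MvPowerSeries.X k ∈ serIdeal n R ^ 2) :
    Function.Bijective α := by
  have hδ : ∀ m, ∀ p ∈ serIdeal n R ^ m, α p - p ∈ serIdeal n R ^ (m + 1) :=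
    fun m p => sub_mem_serIdeal_pow_succ α hα m
  have hzero : ∀ p : Ser n R, (∀ m, p ∈ serIdeal n R ^ m) → p = 0 := by
    intro p hp
    ext d
    simpa using mem_serIdeal_pow_iff.1 (hp (d.degree + 1)) d (Nat.lt_succ_self _)
  constructor
  · rw [injective_iff_map_eq_zero]
    intro p hp
    apply hzero
    intro m
    induction m with
    | zero => simp
    | succ m ih =>
      have := hδ m p ih
      rwa [hp, zero_sub, neg_mem_iff] at this
  · intro p
    let δ : Ser n R → Ser n R := fun q => q - α q
    have hδp : ∀ m, δ^[m] p ∈ serIdeal n R ^ m := by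
      intro m
      induction m with
      | zero => simp
      | succ m ih =>
        rw [Function.iterate_succ_apply']
        have := neg_mem (hδ m _ ih)
        rwa [neg_sub] at this
    let s : ℕ → Ser n R := fun m => ∑ k ∈ Finset.range m, δ^[k] p
    have hαs : ∀ m, α (s m) = p - δ^[m] p := by
      intro m
      induction m with
      | zero => simp [s]
      | succ m ih =>
        simp only [s] at ih ⊢
        rw [Finset.sum_range_succ, map_add, ih, Function.iterate_succ_apply']
        simp only [δ]
        ring
    -- the coefficient of `t^d` in the partial sums is constant from the index `|d| + 1` on
    let q : Ser n R := fun d => MvPowerSeries.coeff d (s (d.degree + 1))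
    have hq : ∀ m, q - s m ∈ serIdeal n R ^ m := by
      intro m
      rw [mem_serIdeal_pow_iff]
      intro d hd
      rw [map_sub, sub_eq_zero]
      change MvPowerSeries.coeff d (s (d.degree + 1)) = _
      obtain ⟨l, rfl⟩ := Nat.exists_eq_add_of_le (Nat.succ_le_of_lt hd)
      simp only [s, Nat.succ_eq_add_one]
      rw [Finset.sum_range_add _ (d.degree + 1) l, map_add, left_eq_add, map_sum]
      refine Finset.sum_eq_zero fun k _ => ?_
      exact mem_serIdeal_pow_iff.1 (hδp (d.degree + 1 + k)) d (by omega)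
    refine ⟨q, ?_⟩
    rw [← sub_eq_zero]
    apply hzero
    intro m
    have h1 : α (q - s m) ∈ serIdeal n R ^ m := by
      have := (serIdeal n R ^ m).add_mem (Ideal.pow_le_pow_right m.le_succ (hδ m _ (hq m))) (hq m)
      rwa [sub_add_cancel] at this
    have h2 : α q - p = α (q - s m) - δ^[m] p := by
      rw [map_sub, hαs]; ring
    rw [h2]
    exact (serIdeal n R ^ m).sub_mem h1 (hδp m)

lemma exists_originAut_of_bijective (α : Ser n R →ₐ[R] Ser n R) (hb : Function.Bijective α)
    (h0 : ∀ k, MvPowerSeries.constantCoeff (α (MvPowerSeries.X k)) = 0) :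
    ∃ ρ : originAut n R, ∀ k, ρ.1 (MvPowerSeries.X k) = α (MvPowerSeries.X k) :=
  ⟨⟨AlgEquiv.ofBijective α hb, h0⟩, fun _ => rfl⟩

/-- Substitution `t_k ↦ s k` as an endomorphism of `R[[t]]`. -/
def serSubst (s : Fin n → Ser n R) (hs : ∀ k, MvPowerSeries.constantCoeff (s k) = 0) :
    Ser n R →ₐ[R] Ser n R :=
  MvPowerSeries.substAlgHom (MvPowerSeries.hasSubst_of_constantCoeff_zero hs)

@[simp] lemma serSubst_X (s : Fin n → Ser n R)
    (hs : ∀ k, MvPowerSeries.constantCoeff (s k) = 0) (k : Fin n) :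
    serSubst s hs (MvPowerSeries.X k) = s k :=
  MvPowerSeries.substAlgHom_X _ k

/-- The formal inverse function theorem for power series tangent to the identity. -/
lemma exists_originAut_of_sub_mem (s : Fin n → Ser n R)
    (hs : ∀ k, s k - MvPowerSeries.X k ∈ serIdeal n R ^ 2) :
    ∃ ρ : originAut n R, ∀ k, ρ.1 (MvPowerSeries.X k) = s k := by
  have h0 : ∀ k, MvPowerSeries.constantCoeff (s k) = 0 := fun k => by
    have := mem_serIdeal_iff.1 (Ideal.pow_le_self two_ne_zero (hs k))
    simpa using this
  obtain ⟨ρ, hρ⟩ := exists_originAut_of_bijective (serSubst s h0)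
    (bijective_of_sub_mem _ (fun k => by simpa using hs k)) (fun k => by simpa using h0 k)
  exact ⟨ρ, fun k => by simpa using hρ k⟩

end

/-! ### The Jacobian criterion over affine space -/

section
variable {n : ℕ} {S : Type u} [CommRing S]

/-- An algebra étale over `S[t₁, …, tₙ]` has the differentials of the coordinates as a basis of its
module of differentials over `S`. -/
lemma exists_basis_kaehlerDifferential_of_etale (B : Type u) [CommRing B] [Algebra S B]
    [Algebra (MvPolynomial (Fin n) S) B] [IsScalarTower S (MvPolynomial (Fin n) S) B]
    [Algebra.FormallyEtale (MvPolynomial (Fin n) S) B] :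
    ∃ b : Module.Basis (Fin n) B (Ω[B⁄S]), ∀ i, b i = KaehlerDifferential.D S B
      (algebraMap (MvPolynomial (Fin n) S) B (MvPolynomial.X i)) := by
  refine ⟨((KaehlerDifferential.mvPolynomialBasis S (Fin n)).baseChange B).map
    (KaehlerDifferential.tensorKaehlerEquivOfFormallyEtale S (MvPolynomial (Fin n) S) B),
    fun i => ?_⟩
  simp [KaehlerDifferential.mvPolynomialBasis_apply, KaehlerDifferential.mapBaseChange_tmul]

/-- The Jacobian criterion: elements of a smooth algebra whose differentials are obtained from a
basis by an invertible matrix define an étale map to affine space. -/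
lemma etale_of_isUnit_det_jacobian {T : Type u} [CommRing T] [Algebra S T] [Algebra.Smooth S T]
    (φ : MvPolynomial (Fin n) S →+* T) (hφ : φ.comp MvPolynomial.C = algebraMap S T)
    (b : Module.Basis (Fin n) T (Ω[T⁄S])) (J : Matrix (Fin n) (Fin n) T)
    (hJ : ∀ i, KaehlerDifferential.D S T (φ (MvPolynomial.X i)) = ∑ j, J i j • b j)
    (hdet : IsUnit J.det) : φ.Etale := by
  let := φ.toAlgebra
  have : IsScalarTower S (MvPolynomial (Fin n) S) T := .of_algebraMap_eq' hφ.symm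
  let e := (KaehlerDifferential.mvPolynomialBasis S (Fin n)).baseChange T
  let f := KaehlerDifferential.mapBaseChange S (MvPolynomial (Fin n) S) T
  have hf : LinearMap.toMatrix e b f = J.transpose := by
    ext i j
    have h : f (e j) = ∑ l, J j l • b l := by
      rw [← hJ]
      simp only [e, f, Module.Basis.baseChange_apply, KaehlerDifferential.mapBaseChange_tmul,
        KaehlerDifferential.mvPolynomialBasis_apply, KaehlerDifferential.map_D, one_smul]
      rfl
    rw [LinearMap.toMatrix_apply, h, Matrix.transpose_apply, b.repr_sum_self]
  have hbij : Function.Bijective f := by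
    have : IsUnit (LinearMap.toMatrix e b f).det := by rwa [hf, Matrix.det_transpose]
    exact (LinearEquiv.ofIsUnitDet this).bijective
  refine @Algebra.Etale.mk _ _ _ _ _ ?_
    (Algebra.FinitePresentation.of_restrict_scalars_finitePresentation S _ T)
  constructor
  · refine ⟨fun x y => ?_⟩
    have h0 : ∀ x : Ω[T⁄MvPolynomial (Fin n) S], x = 0 := by
      intro x
      obtain ⟨y, rfl⟩ := KaehlerDifferential.map_surjective S (MvPolynomial (Fin n) S) T x
      exact (KaehlerDifferential.exact_mapBaseChange_map S (MvPolynomial (Fin n) S) T y).2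
        (hbij.2 y)
    rw [h0 x, h0 y]
  · refine ⟨fun x y => ?_⟩
    have h0 : ∀ x : Algebra.H1Cotangent (MvPolynomial (Fin n) S) T, x = 0 := by
      intro x
      have h1 : Algebra.H1Cotangent.δ S (MvPolynomial (Fin n) S) T x = 0 := by
        apply hbij.1
        rw [map_zero]
        exact (Algebra.H1Cotangent.exact_δ_mapBaseChange S (MvPolynomial (Fin n) S) T _).2 ⟨x, rfl⟩
      obtain ⟨y, rfl⟩ := (Algebra.H1Cotangent.exact_map_δ S (MvPolynomial (Fin n) S) T x).1 h1
      rw [Subsingleton.elim y 0, map_zero]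
    rw [h0 x, h0 y]

/-- Let `ψ : S[t] → B` be étale with a section `τ` over the zero section. Elements `∑ a_ij ψ(t_j)`
whose linear part `τ(a_ij)` along `τ` is invertible define an étale map on a neighbourhood of
`τ`. -/
lemma exists_etale_localization {B : Type u} [CommRing B] (ψ : MvPolynomial (Fin n) S →+* B)
    (hψ : ψ.Etale) (τ : B →+* S) (hτ : τ.comp ψ = MvPolynomial.constantCoeff)
    (a : Matrix (Fin n) (Fin n) B) (ha : IsUnit (a.map τ).det) :
    ∃ r : B, IsUnit (τ r) ∧
      (MvPolynomial.eval₂Hom ((algebraMap B (Localization.Away r)).comp (ψ.comp MvPolynomial.C))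
        (fun i => algebraMap B (Localization.Away r)
          (∑ j, a i j * ψ (MvPolynomial.X j)))).Etale := by
  let := ψ.toAlgebra
  let := (ψ.comp MvPolynomial.C).toAlgebra
  have : IsScalarTower S (MvPolynomial (Fin n) S) B := .of_algebraMap_eq' rfl
  have : Algebra.Etale (MvPolynomial (Fin n) S) B := hψ
  obtain ⟨b, hb⟩ := exists_basis_kaehlerDifferential_of_etale (n := n) (S := S) B
  replace hb : ∀ i, b i = KaehlerDifferential.D S B (ψ (MvPolynomial.X i)) := hb
  let φ : Fin n → B := fun i => ∑ j, a i j * ψ (MvPolynomial.X j)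
  let J : Matrix (Fin n) (Fin n) B := fun i l => b.repr (KaehlerDifferential.D S B (φ i)) l
  have hτX : ∀ j, τ (ψ (MvPolynomial.X j)) = 0 := fun j => by
    have := DFunLike.congr_fun hτ (MvPolynomial.X j)
    simpa using this
  have hJ : J.map τ = a.map τ := by
    ext i l
    have h : KaehlerDifferential.D S B (φ i) =
        ∑ j, (a i j • b j + ψ (MvPolynomial.X j) • KaehlerDifferential.D S B (a i j)) := by
      simp only [φ, map_sum, Derivation.leibniz, hb]
    have h2 : J i l = a i l + ∑ j, ψ (MvPolynomial.X j) *
        b.repr (KaehlerDifferential.D S B (a i j)) l := by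
      simp only [J, h]
      rw [Finset.sum_add_distrib, map_add, Finsupp.add_apply, b.repr_sum_self]
      simp [map_sum, Finsupp.finsetSum_apply]
    simp only [Matrix.map_apply, h2, map_add, map_sum, map_mul, hτX, zero_mul,
      Finset.sum_const_zero, add_zero]
  refine ⟨J.det, ?_, ?_⟩
  · rw [RingHom.map_det, RingHom.mapMatrix_apply, hJ]
    exact ha
  · let T := Localization.Away J.det
    have : Algebra.Etale B T := Algebra.Etale.of_isLocalizationAway J.det
    have : Algebra.Etale (MvPolynomial (Fin n) S) T := Algebra.Etale.comp _ B T
    have : IsScalarTower S (MvPolynomial (Fin n) S) T :=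
      .of_algebraMap_eq' (by
        rw [IsScalarTower.algebraMap_eq S B T, IsScalarTower.algebraMap_eq
          (MvPolynomial (Fin n) S) B T, RingHom.comp_assoc]; rfl)
    have : Algebra.Smooth S (MvPolynomial (Fin n) S) := {}
    have : Algebra.Smooth S T := Algebra.Smooth.comp S (MvPolynomial (Fin n) S) T
    obtain ⟨b', hb'⟩ := exists_basis_kaehlerDifferential_of_etale (n := n) (S := S) T
    refine etale_of_isUnit_det_jacobian (T := T) _ ?_ b' (J.map (algebraMap B T)) ?_ ?_
    · ext s
      simp [IsScalarTower.algebraMap_apply S B T]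
      rfl
    · intro i
      have hbb : ∀ l, KaehlerDifferential.map S S B T (b l) = b' l := by
        intro l
        rw [hb, hb', KaehlerDifferential.map_D, IsScalarTower.algebraMap_apply
          (MvPolynomial (Fin n) S) B T]
        rfl
      have h := congrArg (KaehlerDifferential.map S S B T)
        (b.sum_repr (KaehlerDifferential.D S B (φ i)))
      rw [KaehlerDifferential.map_D, map_sum] at h
      rw [MvPolynomial.coe_eval₂Hom, MvPolynomial.eval₂_X]
      refine h.symm.trans (Finset.sum_congr rfl fun l _ => ?_)
      rw [map_smul, hbb, Matrix.map_apply, algebraMap_smul]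
    · rw [← RingHom.mapMatrix_apply, ← RingHom.map_det]
      exact IsLocalization.Away.algebraMap_isUnit J.det

end

/-! ### Taylor series along a section -/

section
variable {n : ℕ} {S : Type u} [CommRing S]

lemma isUnit_of_isUnit_jetAug {c : ℕ} {x : Jet n c S} (hx : IsUnit (jetAug n c S x)) :
    IsUnit x := by
  have h1 : x - algebraMap S _ (jetAug n c S x) ∈ RingHom.ker (jetAug n c S) := by
    simp [RingHom.mem_ker]
  have h2 : IsNilpotent (x - algebraMap S _ (jetAug n c S x)) := by
    refine ⟨c + 1, ?_⟩
    have := Ideal.pow_mem_pow h1 (c + 1)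
    rwa [jet_ker_pow, Ideal.mem_bot] at this
  have h3 := h2.isUnit_add_left_of_commute (hx.map (algebraMap S (Jet n c S))) (Commute.all _ _)
  rwa [add_sub_cancel] at h3

lemma jetAug_comp_mk (n c : ℕ) (S : Type u) [CommRing S] :
    (jetAug n c S).toRingHom.comp (Ideal.Quotient.mk _) = MvPolynomial.constantCoeff := by
  apply MvPolynomial.ringHom_ext
  · intro r
    change jetAug n c S (algebraMap S _ r) = _
    simp
  · intro k
    change jetAug n c S (jetX n c S k) = _
    simp

/-- Let `Spec B → 𝔸ⁿ_S` be the map given by `ψ`, which is étale in the applications, and `τ` a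
section of `Spec B` over the zero section. The functions `φ i` on `Spec B` have Taylor series `s i`
along `τ`, in the coordinates `ψ(t_j)`: the infinitesimal neighbourhoods of the zero section lift to
`Spec B`, extending `τ`, and the `φ i` restrict to the truncations of the `s i`. -/
def HasTaylorSeries {B : Type u} [CommRing B] (ψ : MvPolynomial (Fin n) S →+* B) (τ : B →+* S)
    (φ : Fin n → B) (s : Fin n → Ser n S) : Prop :=
  ∀ c, ∃ ι : B →+* Jet n c S, (jetAug n c S).toRingHom.comp ι = τ ∧
    ι.comp ψ = Ideal.Quotient.mk _ ∧ ∀ i, ι (φ i) = trunc n c S (s i)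

lemma HasTaylorSeries.comp_eq {B : Type u} [CommRing B] {ψ : MvPolynomial (Fin n) S →+* B}
    {τ : B →+* S} {φ : Fin n → B} {s : Fin n → Ser n S} (h : HasTaylorSeries ψ τ φ s) :
    τ.comp ψ = MvPolynomial.constantCoeff := by
  obtain ⟨ι, h1, h2, -⟩ := h 0
  rw [← h1, RingHom.comp_assoc, h2, jetAug_comp_mk]

lemma HasTaylorSeries.apply_eq {B : Type u} [CommRing B] {ψ : MvPolynomial (Fin n) S →+* B}
    {τ : B →+* S} {φ : Fin n → B} {s : Fin n → Ser n S} (h : HasTaylorSeries ψ τ φ s) (i : Fin n) :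
    τ (φ i) = MvPowerSeries.constantCoeff (s i) := by
  obtain ⟨ι, h1, -, h3⟩ := h 0
  rw [← h1, ← jetAug_trunc (c := 0), ← h3]
  rfl

/-- An algebraic description of automorphisms of étale type. Here `Spec B` is an étale
neighbourhood of the zero section via `ψ`, and `ρ` is given by the Taylor series of functions
`∑ a_ij ψ(t_j)` with invertible linear part. -/
lemma mem_etaleAut_of_etale {B : Type u} [CommRing B] (ψ : MvPolynomial (Fin n) S →+* B)
    (hψ : ψ.Etale) (τ : B →+* S)
    (a : Matrix (Fin n) (Fin n) B) (ha : IsUnit (a.map τ).det) (ρ : originAut n S)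
    (hι : HasTaylorSeries ψ τ (fun i => ∑ j, a i j * ψ (MvPolynomial.X j))
      (fun i => ρ.1 (MvPowerSeries.X i))) :
    ρ ∈ etaleAut n S := by
  have hτ := hι.comp_eq
  obtain ⟨r, hr, hφ⟩ := exists_etale_localization ψ hψ τ hτ a ha
  set T := Localization.Away r
  set φ := MvPolynomial.eval₂Hom ((algebraMap B T).comp (ψ.comp MvPolynomial.C))
        (fun i => algebraMap B T (∑ j, a i j * ψ (MvPolynomial.X j))) with hφdef
  let ψ' : MvPolynomial (Fin n) S →+* T := (algebraMap B T).comp ψ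
  have hψ' : ψ'.Etale := RingHom.Etale.stableUnderComposition _ _ hψ
    (RingHom.etale_algebraMap.2 (Algebra.Etale.of_isLocalizationAway r))
  let τ' : T →+* S := IsLocalization.Away.lift r hr
  have hτ' : τ'.comp (algebraMap B T) = τ := IsLocalization.Away.lift_comp r hr
  have hτψ : τ'.comp ψ' = MvPolynomial.constantCoeff := by
    rw [← RingHom.comp_assoc, hτ', hτ]
  have hτX : ∀ j, τ (ψ (MvPolynomial.X j)) = 0 := fun j => by
    have := DFunLike.congr_fun hτ (MvPolynomial.X j)
    simpa using this
  have hφC : φ.comp MvPolynomial.C = ψ'.comp MvPolynomial.C :=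
    MvPolynomial.eval₂Hom_comp_C _ _
  have hφX : ∀ i, φ (MvPolynomial.X i) =
      algebraMap B T (∑ j, a i j * ψ (MvPolynomial.X j)) :=
    fun i => MvPolynomial.eval₂Hom_X' _ _ i
  have hτφ : τ'.comp φ = MvPolynomial.constantCoeff := by
    apply MvPolynomial.ringHom_ext
    · intro s
      have h1 := DFunLike.congr_fun hφC s
      have h2 := DFunLike.congr_fun hτψ (MvPolynomial.C s)
      simp only [RingHom.comp_apply] at h1 h2 ⊢
      rw [h1, h2]
    · intro i
      rw [RingHom.comp_apply, hφX, ← RingHom.comp_apply, hτ']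
      simp [hτX]
  let E : EtaleNbhd n S :=
    { V := Spec (CommRingCat.of T)
      π := Spec.map (CommRingCat.ofHom (ψ'.comp MvPolynomial.C))
      τ := Spec.map (CommRingCat.ofHom τ')
      φ := Spec.map (CommRingCat.ofHom φ)
      ψ := Spec.map (CommRingCat.ofHom ψ')
      section_τ := by
        rw [← Spec.map_comp, ← CommRingCat.ofHom_comp, ← RingHom.comp_assoc, hτψ,
          MvPolynomial.constantCoeff_comp_C, ← Spec.map_id]
        rfl
      etale_φ := HasRingHomProperty.Spec_iff.2 hφ
      etale_ψ := HasRingHomProperty.Spec_iff.2 hψ'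
      φ_proj := by rw [affProj, ← Spec.map_comp, ← CommRingCat.ofHom_comp, hφC]
      ψ_proj := by rw [affProj, ← Spec.map_comp, ← CommRingCat.ofHom_comp]
      τ_φ := by rw [affZero, ← Spec.map_comp, ← CommRingCat.ofHom_comp, hτφ]
      τ_ψ := by rw [affZero, ← Spec.map_comp, ← CommRingCat.ofHom_comp, hτψ] }
  refine ⟨E, fun c => ?_⟩
  obtain ⟨ι, h1, h2, h3⟩ := hι c
  have hu : IsUnit (ι r) := isUnit_of_isUnit_jetAug (by
    have := DFunLike.congr_fun h1 r
    rw [← this] at hr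
    exact hr)
  let ι' : T →+* Jet n c S := IsLocalization.Away.lift r hu
  have hι' : ι'.comp (algebraMap B T) = ι := IsLocalization.Away.lift_comp r hu
  have hι'' : ∀ x, ι' (algebraMap B T x) = ι x := DFunLike.congr_fun hι'
  refine ⟨Spec.map (CommRingCat.ofHom ι'), ?_, ?_, ?_⟩
  · simp only [infZero, E, ← Spec.map_comp, ← CommRingCat.ofHom_comp]
    congr 2
    apply IsLocalization.ringHom_ext (Submonoid.powers r)
    rw [RingHom.comp_assoc, hι', h1, hτ']
  · simp only [infIncl, E, ← Spec.map_comp, ← CommRingCat.ofHom_comp]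
    congr 2
    rw [← RingHom.comp_assoc, hι', h2]
  · simp only [infIncl, infAut, E, ← Spec.map_comp, ← CommRingCat.ofHom_comp]
    congr 2
    apply MvPolynomial.ringHom_ext
    · intro s
      have e1 := DFunLike.congr_fun hφC s
      have e2 := DFunLike.congr_fun h2 (MvPolynomial.C s)
      simp only [RingHom.comp_apply] at e1 e2 ⊢
      rw [e1]
      simp only [ψ', RingHom.comp_apply]
      rw [hι'', e2]
      exact ((jetOfAut n c S ρ).1.commutes s).symm
    · intro i
      rw [RingHom.comp_apply, hφX, hι'', h3, ← jetOfAut_X]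
      rfl

end

/-! ### Affine étale neighbourhoods -/

section
variable {n : ℕ} {R : Type u} [CommRing R]

/-- The zero section and its infinitesimal neighbourhoods have the same points. -/
lemma infZero_surjective (n c : ℕ) (S : Type u) [CommRing S] :
    Function.Surjective (infZero n c S) := by
  intro y
  have hsurj : Function.Surjective (jetAug n c S).toRingHom :=
    fun s => ⟨algebraMap S _ s, (jetAug n c S).commutes s⟩
  have hr := range_comap_of_surjective _ (jetAug n c S).toRingHom hsurj
  have hy : ∀ y : PrimeSpectrum (Jet n c S),
      y ∈ Set.range (PrimeSpectrum.comap (jetAug n c S).toRingHom) := by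
    intro y
    rw [hr, PrimeSpectrum.mem_zeroLocus]
    intro x hx
    have hx' : x ^ (c + 1) ∈ RingHom.ker (jetAug n c S) ^ (c + 1) := Ideal.pow_mem_pow hx _
    rw [jet_ker_pow, Ideal.mem_bot] at hx'
    refine y.isPrime.mem_of_pow_mem (c + 1) ?_
    rw [hx']
    exact zero_mem _
  exact hy y

/-- Zariski locally on the base, an automorphism of étale type comes from an affine étale
neighbourhood. -/
lemma EtaleNbhd.Induces.exists_affine {E : EtaleNbhd n R} {ρ : originAut n R} (hE : E.Induces ρ)
    (p : PrimeSpectrum R) :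
    ∃ f : R, f ∉ p.asIdeal ∧ ∃ (B : CommRingCat.{u}) (ψ φ : MvPolynomial (Fin n) R →+* B)
      (τ : B →+* Localization.Away f), ψ.Etale ∧
      τ.comp ψ = (algebraMap R _).comp MvPolynomial.constantCoeff ∧
      ∀ c, ∃ ι : B →+* Jet n c (Localization.Away f),
        (jetAug n c (Localization.Away f)).toRingHom.comp ι = τ ∧
        ι.comp ψ = (jetMap n c (algebraMap R _)).comp (Ideal.Quotient.mk _) ∧
        ∀ i, ι (φ (MvPolynomial.X i)) =
          jetMap n c (algebraMap R _) (trunc n c R (ρ.1 (MvPowerSeries.X i))) := by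
  have := E.etale_ψ
  obtain ⟨U, hU, hxU, -⟩ := exists_isAffineOpen_mem_and_subset
    (show E.τ p ∈ (⊤ : E.V.Opens) from trivial)
  obtain ⟨_, ⟨f, rfl⟩, hpf, hfU⟩ := PrimeSpectrum.isTopologicalBasis_basic_opens.exists_subset_of_mem_open
    (u := (E.τ ⁻¹ᵁ U).carrier) hxU
    (E.τ ⁻¹ᵁ U).is_open'
  let S := Localization.Away f
  let g : Spec (CommRingCat.of S) ⟶ Spec (CommRingCat.of R) :=
    Spec.map (CommRingCat.ofHom (algebraMap R S))
  have hgU : ∀ y, (g ≫ E.τ) y ∈ U := by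
    intro y
    have h1 : g y ∈ (PrimeSpectrum.basicOpen f : Set (PrimeSpectrum R)) := by
      rw [← PrimeSpectrum.localization_away_comap_range S f]
      exact ⟨y, rfl⟩
    rw [Scheme.Hom.comp_apply]
    exact hfU h1
  let j : ∀ c, infNbhd n c S ⟶ infNbhd n c R :=
    fun c => Spec.map (CommRingCat.ofHom (jetMap n c (algebraMap R S)))
  have hj : ∀ c, infZero n c S ≫ j c = g ≫ infZero n c R := by
    intro c
    simp only [j, infZero, g, ← Spec.map_comp, ← CommRingCat.ofHom_comp]
    congr 1
    exact CommRingCat.hom_ext (RingHom.ext fun x => jetAug_jetMap (algebraMap R S) x)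
  choose ι h1 h2 h3 using hE
  have hιU : ∀ c y, (j c ≫ ι c) y ∈ U := by
    intro c y
    obtain ⟨z, rfl⟩ := infZero_surjective n c S y
    rw [← Scheme.Hom.comp_apply, ← Category.assoc, hj, Category.assoc, h1]
    exact hgU z
  have hr : Set.range hU.fromSpec = U := hU.range_fromSpec
  let τ' := IsOpenImmersion.lift hU.fromSpec (g ≫ E.τ) (by
    rw [hr]; rintro _ ⟨y, rfl⟩; exact hgU y)
  let ι' := fun c => IsOpenImmersion.lift hU.fromSpec (j c ≫ ι c) (by
    rw [hr]; rintro _ ⟨y, rfl⟩; exact hιU c y)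
  have hτ' : τ' ≫ hU.fromSpec = g ≫ E.τ := IsOpenImmersion.lift_fac _ _ _
  have hι' : ∀ c, ι' c ≫ hU.fromSpec = j c ≫ ι c := fun c => IsOpenImmersion.lift_fac _ _ _
  have hinj : ∀ {A : CommRingCat.{u}} {C : CommRingCat.{u}} {a b : A ⟶ C},
      Spec.map a = Spec.map b → a.hom = b.hom := fun h => by rw [Spec.map_injective h]
  refine ⟨f, hpf, Γ(E.V, U), (Spec.preimage (hU.fromSpec ≫ E.ψ)).hom,
    (Spec.preimage (hU.fromSpec ≫ E.φ)).hom, (Spec.preimage τ').hom, ?_, ?_, fun c =>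
    ⟨(Spec.preimage (ι' c)).hom, ?_, ?_, ?_⟩⟩
  · rw [← HasRingHomProperty.Spec_iff (P := @Etale), Spec.map_preimage]
    infer_instance
  · refine hinj (A := CommRingCat.of (MvPolynomial (Fin n) R)) (C := CommRingCat.of S)
      (a := Spec.preimage (hU.fromSpec ≫ E.ψ) ≫ Spec.preimage τ')
      (b := CommRingCat.ofHom MvPolynomial.constantCoeff ≫ CommRingCat.ofHom (algebraMap R S)) ?_
    rw [Spec.map_comp, Spec.map_preimage, Spec.map_preimage, ← Category.assoc, hτ',
      Category.assoc, E.τ_ψ, Spec.map_comp]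
    rfl
  · refine hinj (a := Spec.preimage (ι' c) ≫ CommRingCat.ofHom (jetAug n c S).toRingHom)
      (b := Spec.preimage τ') ?_
    rw [Spec.map_comp, Spec.map_preimage, Spec.map_preimage, ← cancel_mono hU.fromSpec,
      Category.assoc, hι', hτ', ← h1 c, ← Category.assoc, ← Category.assoc]
    exact congrArg (· ≫ ι c) (hj c)
  · refine hinj (A := CommRingCat.of (MvPolynomial (Fin n) R)) (C := CommRingCat.of (Jet n c S))
      (a := Spec.preimage (hU.fromSpec ≫ E.ψ) ≫ Spec.preimage (ι' c))
      (b := CommRingCat.ofHom (Ideal.Quotient.mk _) ≫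
        CommRingCat.ofHom (jetMap n c (algebraMap R S))) ?_
    rw [Spec.map_comp, Spec.map_preimage, Spec.map_preimage, ← Category.assoc, hι',
      Category.assoc, h2, Spec.map_comp]
    rfl
  · intro i
    have : (Spec.preimage (hU.fromSpec ≫ E.φ) ≫ Spec.preimage (ι' c)).hom =
      (CommRingCat.ofHom (Ideal.Quotient.mk _) ≫
        CommRingCat.ofHom ((jetOfAut n c R ρ).1 : Jet n c R →+* Jet n c R) ≫
        CommRingCat.ofHom (jetMap n c (algebraMap R S))).hom := by
      refine hinj (A := CommRingCat.of (MvPolynomial (Fin n) R))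
        (C := CommRingCat.of (Jet n c S)) ?_
      rw [Spec.map_comp, Spec.map_preimage, Spec.map_preimage, ← Category.assoc, hι',
        Category.assoc, h3, Spec.map_comp, Spec.map_comp, Category.assoc]
      rfl
    have h := DFunLike.congr_fun this (MvPolynomial.X i)
    rw [← jetOfAut_X]
    exact h

end

/-! ### Shrinking étale neighbourhoods -/

/-- The base change of an étale ring homomorphism, with its universal property. -/
lemma exists_etale_baseChange {P P' B : Type u} [CommRing P] [CommRing P'] [CommRing B]
    (ψ : P →+* B) (hψ : ψ.Etale) (g : P →+* P') :
    ∃ (B' : CommRingCat.{u}) (ψ' : P' →+* B') (β : B →+* B'), ψ'.Etale ∧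
      (∀ (C : Type u) [CommRing C] (v : B →+* C) (w : P' →+* C), v.comp ψ = w.comp g →
        ∃ z : B' →+* C, z.comp β = v ∧ z.comp ψ' = w) ∧
      (∀ (C : Type u) [CommRing C] (z₁ z₂ : B' →+* C), z₁.comp β = z₂.comp β →
        z₁.comp ψ' = z₂.comp ψ' → z₁ = z₂) := by
  let := ψ.toAlgebra
  let := g.toAlgebra
  have : Algebra.Etale P B := hψ
  refine ⟨CommRingCat.of (P' ⊗[P] B), algebraMap P' (P' ⊗[P] B),
    Algebra.TensorProduct.includeRight.toRingHom, RingHom.etale_algebraMap.2 inferInstance,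
    ?_, ?_⟩
  · intro C _ v w hvw
    let := (w.comp g).toAlgebra
    let v' : B →ₐ[P] C := { v with commutes' := fun p => DFunLike.congr_fun hvw p }
    let w' : P' →ₐ[P] C := { w with commutes' := fun p => rfl }
    refine ⟨(Algebra.TensorProduct.lift w' v' (fun _ _ => Commute.all _ _)).toRingHom, ?_, ?_⟩
    · ext b
      simp [v']
    · ext p
      simp [w', Algebra.TensorProduct.algebraMap_apply]
  · intro C _ z₁ z₂ h1 h2
    exact Algebra.TensorProduct.ringHom_ext h2 h1

section
variable {n : ℕ} {R S : Type u} [CommRing R] [CommRing S]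

/-- The locally affine description of an automorphism of étale type, over the localized base. -/
lemma EtaleNbhd.Induces.exists_hasTaylorSeries {E : EtaleNbhd n R} {ρ : originAut n R}
    (hE : E.Induces ρ) (p : PrimeSpectrum R) :
    ∃ f : R, f ∉ p.asIdeal ∧ ∃ (B : CommRingCat.{u})
      (ψ : MvPolynomial (Fin n) (Localization.Away f) →+* B)
      (τ : B →+* Localization.Away f) (φ : Fin n → B), ψ.Etale ∧
      HasTaylorSeries ψ τ φ (fun i => (originAutMap n (algebraMap R (Localization.Away f)) ρ).1
        (MvPowerSeries.X i)) := by
  obtain ⟨f, hf, B, ψ, φ, τ, hψ, hτ, hι⟩ := hE.exists_affine p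
  refine ⟨f, hf, ?_⟩
  set S := Localization.Away f
  obtain ⟨B', ψ', β, hψ', hex, huniq⟩ :=
    exists_etale_baseChange ψ hψ (MvPolynomial.map (algebraMap R S))
  obtain ⟨τ', h1, h2⟩ := hex S τ MvPolynomial.constantCoeff (by
    rw [hτ]
    apply MvPolynomial.ringHom_ext
    · intro r; simp [S]
    · intro k; simp)
  refine ⟨B', ψ', τ', fun i => β (φ (MvPolynomial.X i)), hψ', fun c => ?_⟩
  obtain ⟨ι, i1, i2, i3⟩ := hι c
  obtain ⟨ι', j1, j2⟩ := hex _ ι (Ideal.Quotient.mk _) (by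
    rw [i2]
    rfl)
  refine ⟨ι', ?_, j2, fun i => ?_⟩
  · refine huniq _ _ _ ?_ ?_
    · rw [RingHom.comp_assoc, j1, i1, h1]
    · rw [RingHom.comp_assoc, j2, h2, jetAug_comp_mk]
  · change ι' (β _) = trunc n c S ((originAutMap n (algebraMap R S) ρ).1 (MvPowerSeries.X i))
    rw [← RingHom.comp_apply, j1, i3, originAutMap_X, jetMap_trunc]

/-- If `ψ : S[t] → B` is étale with a section `τ` over the zero section, the `ψ(t_j)` generate the
ideal of `τ` near `τ`. By étaleness they generate it modulo its square, whence the claim by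
Nakayama's lemma. -/
lemma exists_smul_ker_le {B : Type u} [CommRing B] (ψ : MvPolynomial (Fin n) S →+* B)
    (hψ : ψ.Etale) (τ : B →+* S) (hτ : τ.comp ψ = MvPolynomial.constantCoeff) :
    ∃ r : B, τ r = 1 ∧ ∀ x, τ x = 0 →
      r * x ∈ Ideal.span (Set.range fun j => ψ (MvPolynomial.X j)) := by
  let := ψ.toAlgebra
  let := (ψ.comp MvPolynomial.C).toAlgebra
  have : IsScalarTower S (MvPolynomial (Fin n) S) B := .of_algebraMap_eq' rfl
  have : Algebra.Etale (MvPolynomial (Fin n) S) B := hψ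
  have hτC : ∀ s, τ (ψ (MvPolynomial.C s)) = s := fun s => by
    have := DFunLike.congr_fun hτ (MvPolynomial.C s)
    simpa using this
  let τ' : B →ₐ[S] S := { τ with commutes' := hτC }
  have : Algebra.FinitePresentation S B :=
    Algebra.FinitePresentation.trans S (MvPolynomial (Fin n) S) B
  have hfg : (RingHom.ker τ).FG := Algebra.FinitePresentation.ker_fG_of_surjective τ'
    (fun s => ⟨ψ (MvPolynomial.C s), hτC s⟩)
  set J := RingHom.ker τ
  set N := Ideal.span (Set.range fun j => ψ (MvPolynomial.X j))
  -- modulo `N + J²`, the identity and the retraction `τ` onto constants are two maps of algebras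
  -- over `S[t]` which agree modulo a square-zero ideal, and hence are equal
  let Q := B ⧸ (N ⊔ J • J)
  let q : B →+* Q := Ideal.Quotient.mk _
  let g₁ : B →ₐ[MvPolynomial (Fin n) S] Q := Ideal.Quotient.mkₐ _ _
  have hcomm : (q.comp ((ψ.comp MvPolynomial.C).comp τ)).comp ψ = q.comp ψ := by
    rw [RingHom.comp_assoc, RingHom.comp_assoc, hτ]
    apply MvPolynomial.ringHom_ext
    · intro s
      simp
    · intro k
      have : q (ψ (MvPolynomial.X k)) = 0 := by
        rw [Ideal.Quotient.eq_zero_iff_mem]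
        exact Ideal.mem_sup_left (Ideal.subset_span ⟨k, rfl⟩)
      simp [this]
  let g₂ : B →ₐ[MvPolynomial (Fin n) S] Q :=
    { q.comp ((ψ.comp MvPolynomial.C).comp τ) with
      commutes' := fun p => DFunLike.congr_fun hcomm p }
  have hI : IsNilpotent (J.map q) := by
    refine ⟨2, ?_⟩
    rw [← Ideal.map_pow, pow_two, ← smul_eq_mul, Ideal.zero_eq_bot, Ideal.map_eq_bot_iff_le_ker,
      Ideal.mk_ker]
    exact le_sup_right
  have hg : g₁ = g₂ := by
    refine Algebra.FormallyUnramified.ext (J.map q) hI fun x => ?_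
    rw [Ideal.Quotient.mk_eq_mk_iff_sub_mem]
    change q x - q (ψ (MvPolynomial.C (τ x))) ∈ _
    rw [← map_sub]
    apply Ideal.mem_map_of_mem
    change τ _ = 0
    rw [map_sub, hτC, sub_self]
  have hJ : J ≤ N ⊔ J • J := by
    intro x hx
    rw [← Ideal.Quotient.eq_zero_iff_mem]
    have h := DFunLike.congr_fun hg x
    change q x = q (ψ (MvPolynomial.C (τ x))) at h
    rw [show τ x = 0 from hx, map_zero, map_zero, map_zero] at h
    exact h
  obtain ⟨r, hr1, hr⟩ := Submodule.exists_sub_one_mem_and_smul_le_of_fg_of_le_sup hfg le_rfl hJ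
  refine ⟨r, ?_, fun x hx => ?_⟩
  · have : τ (r - 1) = 0 := hr1
    rwa [map_sub, map_one, sub_eq_zero] at this
  · exact hr (Submodule.smul_mem_pointwise_smul x r J hx)

/-- After shrinking the étale neighbourhood, functions vanishing on the section are linear
combinations of the coordinates. -/
lemma HasTaylorSeries.exists_matrix {B : Type u} [CommRing B]
    {ψ : MvPolynomial (Fin n) S →+* B} {τ : B →+* S} {φ : Fin n → B} {s : Fin n → Ser n S}
    (h : HasTaylorSeries ψ τ φ s) (hψ : ψ.Etale)
    (hs : ∀ i, MvPowerSeries.constantCoeff (s i) = 0) :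
    ∃ (B' : CommRingCat.{u}) (ψ' : MvPolynomial (Fin n) S →+* B') (τ' : B' →+* S)
      (a : Matrix (Fin n) (Fin n) B'), ψ'.Etale ∧
      HasTaylorSeries ψ' τ' (fun i => ∑ j, a i j * ψ' (MvPolynomial.X j)) s := by
  obtain ⟨r, hr1, hr⟩ := exists_smul_ker_le ψ hψ τ h.comp_eq
  have hmem : ∀ i, ∃ a : Fin n → B, ∑ j, a j * ψ (MvPolynomial.X j) = r * φ i := fun i =>
    Ideal.mem_span_range_iff_exists_fun.1 (hr _ (by rw [h.apply_eq, hs]))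
  choose a ha using hmem
  let T := Localization.Away r
  have hrT : IsUnit (algebraMap B T r) := IsLocalization.Away.algebraMap_isUnit r
  have hru : IsUnit (τ r) := by rw [hr1]; exact isUnit_one
  obtain ⟨e, he⟩ := hrT.exists_left_inv
  let τ' : T →+* S := IsLocalization.Away.lift r hru
  have hτ' : τ'.comp (algebraMap B T) = τ := IsLocalization.Away.lift_comp r hru
  refine ⟨CommRingCat.of T, (algebraMap B T).comp ψ, τ', fun i j => e * algebraMap B T (a i j),
    RingHom.Etale.stableUnderComposition _ _ hψ
    (RingHom.etale_algebraMap.2 (Algebra.Etale.of_isLocalizationAway r)), fun c => ?_⟩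
  obtain ⟨ι, i1, i2, i3⟩ := h c
  have hu : IsUnit (ι r) := isUnit_of_isUnit_jetAug (by
    have := DFunLike.congr_fun i1 r
    rw [← this] at hru
    exact hru)
  let ι' : T →+* Jet n c S := IsLocalization.Away.lift r hu
  have hι' : ι'.comp (algebraMap B T) = ι := IsLocalization.Away.lift_comp r hu
  have h1 : (jetAug n c S).toRingHom.comp ι' = τ' := by
    apply IsLocalization.ringHom_ext (Submonoid.powers r)
    rw [RingHom.comp_assoc, hι', hτ', i1]
  have h2 : ι'.comp ((algebraMap B T).comp ψ) = Ideal.Quotient.mk _ := by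
    rw [← RingHom.comp_assoc, hι', i2]
  have h3 : ∀ i, ι' (∑ j, e * algebraMap B T (a i j) *
      ((algebraMap B T).comp ψ) (MvPolynomial.X j)) = trunc n c S (s i) := by
    intro i
    have : ∑ j, e * algebraMap B T (a i j) * ((algebraMap B T).comp ψ) (MvPolynomial.X j) =
        algebraMap B T (φ i) := by
      simp only [RingHom.comp_apply, mul_assoc, ← map_mul]
      rw [← Finset.mul_sum, ← map_sum, ha, map_mul, ← mul_assoc, he, one_mul]
    rw [this, ← i3, ← hι']
    rfl
  exact ⟨ι', h1, h2, h3⟩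

end

/-! ### Deformation to the linear part -/

section
variable {n : ℕ} {S : Type u} [CommRing S]

lemma coeff_single_sum_mul_X (q : Fin n → Ser n S) (l : Fin n) :
    MvPowerSeries.coeff (Finsupp.single l 1) (∑ j, q j * MvPowerSeries.X j) =
      MvPowerSeries.constantCoeff (q l) := by
  classical
  rw [map_sum, Finset.sum_eq_single l]
  · simpa [MvPowerSeries.X] using MvPowerSeries.coeff_add_mul_monomial
      (0 : Fin n →₀ ℕ) (Finsupp.single l 1) (q l) (1 : S)
  · intro j _ hj
    rw [MvPowerSeries.X, MvPowerSeries.coeff_mul_monomial, if_neg]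
    rw [Finsupp.single_le_iff, Finsupp.single_apply, if_neg (Ne.symm hj)]
    omega
  · simp

lemma coeff_rescale_const {R : Type u} [CommRing R] (a : R) (p : Ser n R) (d : Fin n →₀ ℕ) :
    MvPowerSeries.coeff d (MvPowerSeries.rescale (fun _ => a) p) =
      a ^ d.degree * MvPowerSeries.coeff d p := by
  rw [MvPowerSeries.coeff_rescale, Finsupp.prod, Finset.prod_pow_eq_pow_sum, Finsupp.degree_apply]

/-- `y` is the family of automorphisms `λ⁻¹ ρ(λ t)` of the formal disc, over the affine line with
coordinate `λ`: the deformation of `ρ` to its linear part at `λ = 0`. -/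
def IsDilation (ρ : originAut n S) (y : originAut n (Polynomial S)) : Prop :=
  ∀ i, MvPowerSeries.C (Polynomial.X : Polynomial S) * y.1 (MvPowerSeries.X i) =
    MvPowerSeries.rescale (fun _ => (Polynomial.X : Polynomial S))
      (MvPowerSeries.map Polynomial.C (ρ.1 (MvPowerSeries.X i)))

lemma IsDilation.coeff_eq {ρ : originAut n S} {y : originAut n (Polynomial S)}
    (h : IsDilation ρ y) (i : Fin n) {d : Fin n →₀ ℕ} (hd : d ≠ 0) :
    MvPowerSeries.coeff d (y.1 (MvPowerSeries.X i)) =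
      Polynomial.X ^ (d.degree - 1) *
        Polynomial.C (MvPowerSeries.coeff d (ρ.1 (MvPowerSeries.X i))) := by
  have h1 := congrArg (MvPowerSeries.coeff d) (h i)
  rw [MvPowerSeries.coeff_C_mul, coeff_rescale_const, MvPowerSeries.coeff_map] at h1
  have h2 : d.degree = d.degree - 1 + 1 := by
    have : d.degree ≠ 0 := fun h0 => hd ((Finsupp.degree_eq_zero_iff d).1 h0)
    omega
  rw [h2, pow_succ', mul_assoc] at h1
  exact Polynomial.isRegular_X.left h1

lemma exists_isDilation (ρ : originAut n S)
    (hρ : ∀ i, ρ.1 (MvPowerSeries.X i) - MvPowerSeries.X i ∈ serIdeal n S ^ 2) :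
    ∃ y, IsDilation ρ y := by
  classical
  -- the truncated subtraction at `d = 0` is harmless, as `ρ` preserves the origin
  let s : Fin n → Ser n (Polynomial S) := fun i d => Polynomial.X ^ (d.degree - 1) *
        Polynomial.C (MvPowerSeries.coeff d (ρ.1 (MvPowerSeries.X i)))
  have hs : ∀ i d, MvPowerSeries.coeff d (s i) = Polynomial.X ^ (d.degree - 1) *
        Polynomial.C (MvPowerSeries.coeff d (ρ.1 (MvPowerSeries.X i))) := fun _ _ => rfl
  obtain ⟨y, hy⟩ := exists_originAut_of_sub_mem s (fun i => by
    rw [mem_serIdeal_pow_iff]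
    intro d hd
    have h := mem_serIdeal_pow_iff.1 (hρ i) d hd
    rw [map_sub, sub_eq_zero] at h
    have h1 : d.degree - 1 = 0 := by omega
    rw [map_sub, hs, h, h1, pow_zero, one_mul, MvPowerSeries.coeff_X, MvPowerSeries.coeff_X]
    split_ifs <;> simp)
  refine ⟨y, fun i => ?_⟩
  ext1 d
  rw [MvPowerSeries.coeff_C_mul, hy, hs, coeff_rescale_const, MvPowerSeries.coeff_map, ← mul_assoc]
  by_cases hd : d = 0
  · subst hd
    have h0 := ρ.2 i
    rw [MvPowerSeries.coeff_zero_eq_constantCoeff_apply, h0]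
    simp
  · have : d.degree ≠ 0 := fun h0 => hd ((Finsupp.degree_eq_zero_iff d).1 h0)
    rw [← pow_succ', Nat.sub_add_cancel (by omega)]

/-- The substitution `t ↦ λ t` from jets over `S` to jets over `S[λ]`. -/
def jetRescale (n c : ℕ) (S : Type u) [CommRing S] : Jet n c S →+* Jet n c (Polynomial S) :=
  (jetHom (fun k => algebraMap _ _ (Polynomial.X : Polynomial S) * jetX n c (Polynomial S) k)
    (fun k => by simp)).toRingHom.comp (jetMap n c Polynomial.C)

lemma jetRescale_algebraMap (c : ℕ) (s : S) :
    jetRescale n c S (algebraMap _ _ s) = algebraMap _ _ (Polynomial.C s) := by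
  rw [jetRescale, RingHom.comp_apply, jetMap_algebraMap]
  exact AlgHom.commutes _ _

lemma jetRescale_X (c : ℕ) (k : Fin n) :
    jetRescale n c S (jetX n c S k) =
      algebraMap _ _ (Polynomial.X : Polynomial S) * jetX n c (Polynomial S) k := by
  rw [jetRescale, RingHom.comp_apply, jetMap_X]
  exact jetHom_X _ _ k

lemma jetRescale_trunc (c : ℕ) (p : Ser n S) :
    jetRescale n c S (trunc n c S p) = trunc n c (Polynomial S)
      (MvPowerSeries.rescale (fun _ => (Polynomial.X : Polynomial S))
        (MvPowerSeries.map Polynomial.C p)) := by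
  have hC : ∀ r : Polynomial S, MvPowerSeries.rescale (fun _ : Fin n => (Polynomial.X : Polynomial S))
      (MvPowerSeries.C r) = MvPowerSeries.C r := fun r => by
    rw [← MvPowerSeries.rescaleAlgHom_apply]
    exact (MvPowerSeries.rescaleAlgHom _).commutes r
  have hX : ∀ k, MvPowerSeries.rescale (fun _ : Fin n => (Polynomial.X : Polynomial S))
      (MvPowerSeries.X k) = MvPowerSeries.C Polynomial.X * MvPowerSeries.X k := fun k => by
    classical
    ext1 d
    rw [coeff_rescale_const, MvPowerSeries.coeff_C_mul, MvPowerSeries.coeff_X]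
    split_ifs with h
    · simp [h]
    · simp
  have : (jetRescale n c S).comp (trunc n c S) = ((trunc n c (Polynomial S)).comp
      (MvPowerSeries.rescale (fun _ => (Polynomial.X : Polynomial S)))).comp
        (MvPowerSeries.map Polynomial.C) :=
    ser_hom_ext _ _ jet_ker_pow _ _
      (fun r => by simp [jetRescale_algebraMap, hC])
      (fun k => by simp [jetRescale_X, hX])
      (fun k => by simp [jetRescale_X, RingHom.mem_ker])
  exact DFunLike.congr_fun this p

lemma jetAug_jetRescale (c : ℕ) (x : Jet n c S) :
    jetAug n c (Polynomial S) (jetRescale n c S x) = Polynomial.C (jetAug n c S x) := by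
  have : (jetAug n c (Polynomial S)).toRingHom.comp (jetRescale n c S) =
      Polynomial.C.comp (jetAug n c S).toRingHom :=
    jet_hom_ext (fun r => by simp [jetRescale_algebraMap]) (fun k => by simp [jetRescale_X])
  exact DFunLike.congr_fun this x

lemma trunc_surjective (n c : ℕ) (S : Type u) [CommRing S] :
    Function.Surjective (trunc n c S) := by
  intro x
  obtain ⟨p, rfl⟩ := Ideal.Quotient.mk_surjective x
  exact ⟨p, trunc_coe p⟩

lemma eq_of_algebraMap_X_mul_eq {c : ℕ} {x y : Jet n c (Polynomial S)}
    (h : algebraMap _ _ (Polynomial.X : Polynomial S) * x =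
      algebraMap _ _ (Polynomial.X : Polynomial S) * y) : x = y := by
  obtain ⟨p, rfl⟩ := trunc_surjective _ _ _ x
  obtain ⟨q, rfl⟩ := trunc_surjective _ _ _ y
  rw [← sub_eq_zero, ← map_sub, trunc_eq_zero_iff_coeff]
  rw [← sub_eq_zero, ← mul_sub, ← map_sub, ← trunc_C, ← map_mul, trunc_eq_zero_iff_coeff] at h
  intro d hd
  have := h d hd
  rw [MvPowerSeries.coeff_C_mul] at this
  exact Polynomial.isRegular_X.left (this.trans (mul_zero _).symm)

/-- The linear part along the section of a family of functions tangent to the coordinates is the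
identity matrix. -/
lemma HasTaylorSeries.map_matrix_eq_one {B : Type u} [CommRing B]
    {ψ : MvPolynomial (Fin n) S →+* B} {τ : B →+* S} {a : Matrix (Fin n) (Fin n) B}
    {s : Fin n → Ser n S}
    (h : HasTaylorSeries ψ τ (fun i => ∑ j, a i j * ψ (MvPolynomial.X j)) s)
    (hs : ∀ i, s i - MvPowerSeries.X i ∈ serIdeal n S ^ 2) : a.map τ = 1 := by
  classical
  obtain ⟨ι, h1, h2, h3⟩ := h 1
  have hq : ∀ i j, ∃ q, trunc n 1 S q = ι (a i j) := fun i j => trunc_surjective _ _ _ _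
  choose q hq using hq
  have hX : ∀ j, ι (ψ (MvPolynomial.X j)) = trunc n 1 S (MvPowerSeries.X j) := fun j => by
    rw [trunc_X]
    exact DFunLike.congr_fun h2 (MvPolynomial.X j)
  ext i l
  have e1 : trunc n 1 S (∑ j, q i j * MvPowerSeries.X j - MvPowerSeries.X i) = 0 := by
    have e2 := h3 i
    have e3 := trunc_eq_zero_of_mem (hs i)
    rw [map_sub, sub_eq_zero] at e3
    rw [map_sub, sub_eq_zero, ← e3, ← e2]
    simp only [map_sum, map_mul, hq, hX]
  have e4 := trunc_eq_zero_iff_coeff.1 e1 (Finsupp.single l 1) (by simp)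
  rw [map_sub, sub_eq_zero, coeff_single_sum_mul_X, MvPowerSeries.coeff_X, ← jetAug_trunc (c := 1),
    hq] at e4
  have e5 : τ (a i l) = jetAug n 1 S (ι (a i l)) := (DFunLike.congr_fun h1 _).symm
  rw [Matrix.map_apply, e5, e4, Matrix.one_apply]
  simp only [Finsupp.single_left_inj one_ne_zero, eq_comm]

/-- Deformation to the normal cone: if `ρ` is given by étale functions then so is the family
`λ⁻¹ ρ(λ t)`. The étale neighbourhood is the base change of that of `ρ` along `t ↦ λ t`. If
`φ_i = ∑ a_ij ψ(t_j)`, then `λ⁻¹ φ_i` makes sense as the function `∑ a_ij t_j` on it. -/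
lemma IsDilation.mem_etaleAut {B : Type u} [CommRing B] {ψ : MvPolynomial (Fin n) S →+* B}
    (hψ : ψ.Etale) {τ : B →+* S} {a : Matrix (Fin n) (Fin n) B} {ρ : originAut n S}
    (h : HasTaylorSeries ψ τ (fun i => ∑ j, a i j * ψ (MvPolynomial.X j))
      (fun i => ρ.1 (MvPowerSeries.X i)))
    (hρ : ∀ i, ρ.1 (MvPowerSeries.X i) - MvPowerSeries.X i ∈ serIdeal n S ^ 2)
    {y : originAut n (Polynomial S)} (hy : IsDilation ρ y) : y ∈ etaleAut n (Polynomial S) := by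
  have ha := h.map_matrix_eq_one hρ
  let g : MvPolynomial (Fin n) S →+* MvPolynomial (Fin n) (Polynomial S) :=
    MvPolynomial.eval₂Hom (MvPolynomial.C.comp Polynomial.C)
      (fun j => MvPolynomial.C Polynomial.X * MvPolynomial.X j)
  have hgX : ∀ j, g (MvPolynomial.X j) = MvPolynomial.C Polynomial.X * MvPolynomial.X j :=
    fun j => MvPolynomial.eval₂Hom_X' _ _ j
  have hgC : ∀ s, g (MvPolynomial.C s) = MvPolynomial.C (Polynomial.C s) :=
    fun s => MvPolynomial.eval₂Hom_C _ _ s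
  obtain ⟨B', ψ', β, hψ', hex, huniq⟩ := exists_etale_baseChange ψ hψ g
  obtain ⟨τ', t1, t2⟩ := hex _ (Polynomial.C.comp τ) MvPolynomial.constantCoeff (by
    rw [RingHom.comp_assoc, h.comp_eq]
    apply MvPolynomial.ringHom_ext
    · intro r; simp [hgC]
    · intro k; simp [hgX])
  refine mem_etaleAut_of_etale ψ' hψ' τ' (a.map β) ?_ y (fun c => ?_)
  · have : (a.map β).map τ' = (a.map τ).map Polynomial.C := by
      ext1 i j
      exact DFunLike.congr_fun t1 (a i j)
    rw [this, ha, Matrix.map_one _ (map_zero _) (map_one _), Matrix.det_one]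
    exact isUnit_one
  · obtain ⟨ι, i1, i2, i3⟩ := h c
    obtain ⟨ι', j1, j2⟩ := hex _ ((jetRescale n c S).comp ι) (Ideal.Quotient.mk _) (by
      rw [RingHom.comp_assoc, i2]
      apply MvPolynomial.ringHom_ext
      · intro r
        rw [RingHom.comp_apply, RingHom.comp_apply, hgC]
        exact jetRescale_algebraMap c r
      · intro k
        rw [RingHom.comp_apply, RingHom.comp_apply, hgX, map_mul]
        exact jetRescale_X c k)
    have j2X : ∀ j, ι' (ψ' (MvPolynomial.X j)) = jetX n c _ j :=
      fun j => DFunLike.congr_fun j2 (MvPolynomial.X j)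
    refine ⟨ι', ?_, j2, fun i => ?_⟩
    · refine huniq _ _ _ ?_ ?_
      · rw [RingHom.comp_assoc, j1, t1]
        ext1 b
        have := DFunLike.congr_fun i1 b
        rw [RingHom.comp_apply, RingHom.comp_apply Polynomial.C, ← this]
        exact jetAug_jetRescale c (ι b)
      · rw [RingHom.comp_assoc, j2, t2, jetAug_comp_mk]
    · apply eq_of_algebraMap_X_mul_eq
      rw [← trunc_C, ← map_mul, hy i, ← jetRescale_trunc, ← i3 i, map_sum, map_sum, map_sum,
        Finset.mul_sum]
      refine Finset.sum_congr rfl fun j _ => ?_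
      have e1 : ι (ψ (MvPolynomial.X j)) = jetX n c S j :=
        DFunLike.congr_fun i2 (MvPolynomial.X j)
      have e2 : ι' (β (a i j)) = jetRescale n c S (ι (a i j)) := DFunLike.congr_fun j1 (a i j)
      rw [map_mul, map_mul, map_mul, e1, jetRescale_X, j2X, Matrix.map_apply, e2, trunc_C]
      ring

end

lemma map_sub_X_mem {n : ℕ} {R S : Type u} [CommRing R] [CommRing S] (f : R →+* S)
    {ρ : originAut n R} {m : ℕ}
    (hρ : ∀ i, ρ.1 (MvPowerSeries.X i) - MvPowerSeries.X i ∈ serIdeal n R ^ m) (i : Fin n) :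
    (originAutMap n f ρ).1 (MvPowerSeries.X i) - MvPowerSeries.X i ∈ serIdeal n S ^ m := by
  rw [originAutMap_X, ← MvPowerSeries.map_X f, ← map_sub, mem_serIdeal_pow_iff]
  intro d hd
  rw [MvPowerSeries.coeff_map, mem_serIdeal_pow_iff.1 (hρ i) d hd, map_zero]

/-- Zariski locally on the base, the dilation of an automorphism of étale type is of étale type. -/
lemma exists_isDilation_mem_etaleAut {n : ℕ} {R : Type u} [CommRing R] {ρ : originAut n R}
    (hρ : ρ ∈ etaleAut n R)
    (h2 : ∀ i, ρ.1 (MvPowerSeries.X i) - MvPowerSeries.X i ∈ serIdeal n R ^ 2)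
    (p : PrimeSpectrum R) :
    ∃ f : R, f ∉ p.asIdeal ∧ ∃ y ∈ etaleAut n (Polynomial (Localization.Away f)),
      IsDilation (originAutMap n (algebraMap R (Localization.Away f)) ρ) y := by
  obtain ⟨E, hE⟩ := hρ
  obtain ⟨f, hf, B, ψ, τ, φ, hψ, h⟩ := hE.exists_hasTaylorSeries p
  obtain ⟨B', ψ', τ', a, hψ', h'⟩ := h.exists_matrix hψ (fun i => (originAutMap n _ ρ).2 i)
  have h2' := map_sub_X_mem (algebraMap R (Localization.Away f)) h2
  obtain ⟨y, hy⟩ := exists_isDilation _ h2'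
  exact ⟨f, hf, y, hy.mem_etaleAut hψ' h' h2', hy⟩

open scoped LaurentPolynomial

/-! ### Degrees of Laurent polynomials -/

/-- The Laurent polynomial `p` has no terms of degree above `D`. -/
def LaurentDegreeLE {R : Type u} [CommRing R] (D : ℕ) (p : R[T;T⁻¹]) : Prop :=
  ∀ e : ℤ, (D : ℤ) < e → p.coeff e = 0

section
variable {R : Type u} [CommRing R]

lemma LaurentDegreeLE.mul {D E : ℕ} {p q : R[T;T⁻¹]} (hp : LaurentDegreeLE D p)
    (hq : LaurentDegreeLE E q) : LaurentDegreeLE (D + E) (p * q) := by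
  intro e he
  rw [AddMonoidAlgebra.coeff_mul]
  refine Finset.sum_eq_zero fun a _ => Finset.sum_eq_zero fun b _ => ?_
  dsimp only
  split_ifs with h
  · by_cases ha : (D : ℤ) < a
    · rw [hp a ha, zero_mul]
    · rw [hq b (by push_cast at he; omega), mul_zero]
  · rfl

lemma LaurentDegreeLE.sum {ι : Type*} {s : Finset ι} {D : ℕ} {p : ι → R[T;T⁻¹]}
    (hp : ∀ i ∈ s, LaurentDegreeLE D (p i)) : LaurentDegreeLE D (∑ i ∈ s, p i) := by
  intro e he
  rw [AddMonoidAlgebra.coeff_sum, Finsupp.finsetSum_apply]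
  exact Finset.sum_eq_zero fun i hi => hp i hi e he

lemma laurentDegreeLE_algebraMap (r : R) : LaurentDegreeLE 0 (algebraMap R R[T;T⁻¹] r) := by
  intro e he
  change (LaurentPolynomial.C r).coeff e = 0
  rw [LaurentPolynomial.C_apply, if_neg]
  push_cast at he
  omega

lemma exists_forall_laurentDegreeLE {ι : Type*} [Finite ι] (p : ι → R[T;T⁻¹]) :
    ∃ D, ∀ i, LaurentDegreeLE D (p i) := by
  have h : ∀ᶠ D : ℕ in Filter.atTop, ∀ i, LaurentDegreeLE D (p i) := by
    rw [Filter.eventually_all]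
    intro i
    filter_upwards [Filter.eventually_ge_atTop ((p i).coeff.support.sup Int.toNat)] with D hD e he
    by_contra h0
    have := (Finset.le_sup (f := Int.toNat) (Finsupp.mem_support_iff.2 h0)).trans hD
    omega
  exact h.exists

lemma LaurentDegreeLE.matrix_mul {ι : Type*} [Fintype ι] {D E : ℕ} {M N : Matrix ι ι R[T;T⁻¹]}
    (hM : ∀ i j, LaurentDegreeLE D (M i j)) (hN : ∀ i j, LaurentDegreeLE E (N i j)) (i j : ι) :
    LaurentDegreeLE (D + E) ((M * N) i j) :=
  LaurentDegreeLE.sum fun l _ => (hM i l).mul (hN l j)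

lemma LaurentDegreeLE.coeff_eq_zero {D : ℕ} {p : Polynomial R}
    (h : LaurentDegreeLE D (Polynomial.toLaurent p)) {e : ℕ} (he : D < e) : p.coeff e = 0 := by
  have h1 := h e (by exact_mod_cast he)
  rw [LaurentPolynomial.coeff_toLaurent] at h1
  change Finsupp.mapDomain Nat.castEmbedding p.toFinsupp.coeff (Nat.castEmbedding e) = 0 at h1
  rwa [Finsupp.mapDomain_apply Nat.castEmbedding.injective] at h1

/-- A polynomial matrix which is the identity to an order exceeding its degree is the identity. -/
lemma matrix_eq_one_of_laurentDegreeLE {ι : Type*} [DecidableEq ι] {c D : ℕ} (hc : D < c)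
    (Y : Matrix ι ι (Polynomial R))
    (hY : Y.map (Ideal.Quotient.mk (Ideal.span {(Polynomial.X : Polynomial R) ^ c})) = 1)
    (hD : ∀ i j, LaurentDegreeLE D (Polynomial.toLaurent (Y i j))) : Y = 1 := by
  rw [← Matrix.map_one (Ideal.Quotient.mk (Ideal.span {(Polynomial.X : Polynomial R) ^ c}))
    (map_zero _) (map_one _)] at hY
  ext i j e
  by_cases he : e < c
  · have h1 : Ideal.Quotient.mk (Ideal.span {(Polynomial.X : Polynomial R) ^ c}) (Y i j) =
        Ideal.Quotient.mk _ ((1 : Matrix ι ι (Polynomial R)) i j) := congrFun (congrFun hY i) j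
    rw [Ideal.Quotient.mk_eq_mk_iff_sub_mem, Ideal.mem_span_singleton,
      Polynomial.X_pow_dvd_iff] at h1
    have := h1 e he
    rwa [Polynomial.coeff_sub, sub_eq_zero] at this
  · rw [(hD i j).coeff_eq_zero (by omega), Matrix.one_apply]
    split_ifs
    · rw [Polynomial.coeff_one, if_neg (by omega)]
    · simp

lemma eq_zero_of_locally_eq_zero {r : R} (h : ∀ p : PrimeSpectrum R, ∃ f : R, f ∉ p.asIdeal ∧
    algebraMap R (Localization.Away f) r = 0) : r = 0 := by
  by_contra hr
  have hI : Ideal.span {r} ≠ ⊥ := by simpa using hr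
  -- the annihilator of `r` would lie in a maximal ideal
  obtain ⟨m, hm, hle⟩ := Ideal.exists_le_maximal (Submodule.annihilator (Ideal.span {r}))
    (by rwa [Ne, Submodule.annihilator_eq_top_iff])
  obtain ⟨f, hf, h0⟩ := h ⟨m, hm.isPrime⟩
  rw [IsLocalization.map_eq_zero_iff (Submonoid.powers f)] at h0
  obtain ⟨⟨_, N, rfl⟩, hN⟩ := h0
  apply hf
  apply hm.isPrime.mem_of_pow_mem N
  apply hle
  rw [Submodule.mem_annihilator_span_singleton]
  exact hN

end

/-! ### Matrices of representations -/

section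
variable {k : Type u} [Field k] {V : Type u} [AddCommGroup V] [Module k V]
  {H : GrpPreStk k} {ι : Type*} [Fintype ι] [DecidableEq ι]

/-- The matrices by which a representation acts, in a basis of `V`. -/
def repMatrix (ρ : Representation H V) (b : Module.Basis ι k V) (R : CommAlgCat.{u} k) :
    H.obj R →* Matrix ι ι R :=
  ((LinearMap.toMatrixAlgEquiv (Algebra.TensorProduct.basis R b) : _ →* _).comp
    (Units.coeHom (Module.End R (R ⊗[k] V)))).comp (ρ.app R).hom

variable (ρ : Representation H V) (b : Module.Basis ι k V)

lemma repMatrix_map {R S : CommAlgCat.{u} k} (f : R ⟶ S) (x : H.obj R) :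
    repMatrix ρ b S (H.map f x) = (repMatrix ρ b R x).map f.hom := by
  have hnat : (ρ.app S).hom (H.map f x) = ((GLV V).map f).hom ((ρ.app R).hom x) :=
    DFunLike.congr_fun (congrArg GrpCat.Hom.hom (ρ.naturality f)) x
  ext i j
  change LinearMap.toMatrixAlgEquiv (Algebra.TensorProduct.basis S b)
    ((ρ.app S).hom (H.map f x) : LinearMap.GeneralLinearGroup S (S ⊗[k] V)).val i j = _
  rw [hnat]
  change LinearMap.toMatrixAlgEquiv (Algebra.TensorProduct.basis S b)
    (endMap V f ((ρ.app R).hom x : LinearMap.GeneralLinearGroup R (R ⊗[k] V)).val) i j =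
    f.hom (LinearMap.toMatrixAlgEquiv (Algebra.TensorProduct.basis R b)
      ((ρ.app R).hom x : LinearMap.GeneralLinearGroup R (R ⊗[k] V)).val i j)
  rw [LinearMap.toMatrixAlgEquiv_apply, LinearMap.toMatrixAlgEquiv_apply,
    Algebra.TensorProduct.basis_apply, Algebra.TensorProduct.basis_apply, endMap_tmul, one_smul]
  generalize ((ρ.app R).hom x : LinearMap.GeneralLinearGroup R (R ⊗[k] V)).val (1 ⊗ₜ b j) = w
  induction w with
  | zero => simp
  | add x y hx hy => simp only [map_add, Finsupp.add_apply, hx, hy]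
  | tmul r v =>
    rw [scalarMap_tmul, Algebra.TensorProduct.basis_repr_tmul,
      Algebra.TensorProduct.basis_repr_tmul]
    simp

lemma app_eq_one_of_repMatrix {R : CommAlgCat.{u} k} {x : H.obj R}
    (h : repMatrix ρ b R x = 1) : (ρ.app R).hom x = 1 := by
  apply Units.ext
  apply (LinearMap.toMatrixAlgEquiv (Algebra.TensorProduct.basis R b)).injective
  exact h.trans (map_one _).symm

lemma repMatrix_of_app_eq_one {R : CommAlgCat.{u} k} {x : H.obj R}
    (h : (ρ.app R).hom x = 1) : repMatrix ρ b R x = 1 := by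
  change LinearMap.toMatrixAlgEquiv (Algebra.TensorProduct.basis R b)
    ((ρ.app R).hom x : LinearMap.GeneralLinearGroup R (R ⊗[k] V)).val = 1
  rw [h]
  exact map_one _

/-- Triviality of a representation at a point may be checked Zariski locally on the base. -/
lemma app_eq_one_of_locally [FiniteDimensional k V] {R : CommAlgCat.{u} k} {x : H.obj R}
    (h : ∀ p : PrimeSpectrum R, ∃ f : R, f ∉ p.asIdeal ∧
      (ρ.app (CommAlgCat.of k (Localization.Away f))).hom
        (H.map (CommAlgCat.ofHom (IsScalarTower.toAlgHom k R (Localization.Away f))) x) = 1) :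
    (ρ.app R).hom x = 1 := by
  let b := Module.finBasis k V
  apply app_eq_one_of_repMatrix ρ b
  ext i j
  rw [← sub_eq_zero]
  refine eq_zero_of_locally_eq_zero fun p => ?_
  obtain ⟨f, hf, h1⟩ := h p
  refine ⟨f, hf, ?_⟩
  have h2 := repMatrix_of_app_eq_one ρ b h1
  rw [repMatrix_map] at h2
  have h3 : algebraMap R (Localization.Away f) (repMatrix ρ b R x i j) =
      (1 : Matrix _ _ (Localization.Away f)) i j := congrFun (congrFun h2 i) j
  rw [map_sub, h3, sub_eq_zero, Matrix.one_apply, Matrix.one_apply]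
  split_ifs <;> simp

variable (k) in
/-- `R[λ] → R[λ] / (λ^c)` -/
def modPow (R : CommAlgCat.{u} k) (c : ℕ) :
    CommAlgCat.of k (Polynomial R) ⟶ CommAlgCat.of k
      (Polynomial R ⧸ Ideal.span {(Polynomial.X : Polynomial R) ^ c}) :=
  CommAlgCat.ofHom (Ideal.Quotient.mkₐ k _)

variable (k) in
/-- `R[λ] → R, λ ↦ 1` -/
def evalOne (R : CommAlgCat.{u} k) : CommAlgCat.of k (Polynomial R) ⟶ R :=
  CommAlgCat.ofHom ((Polynomial.aeval (1 : R)).restrictScalars k)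

variable (k) in
/-- `R[λ] → R[λ, λ⁻¹]` -/
def toLaurent (R : CommAlgCat.{u} k) :
    CommAlgCat.of k (Polynomial R) ⟶ CommAlgCat.of k (R[T;T⁻¹]) :=
  CommAlgCat.ofHom (Polynomial.toLaurentAlg.restrictScalars k)

variable (k) in
/-- `R → R[λ, λ⁻¹]` -/
def constLaurent (R : CommAlgCat.{u} k) : R ⟶ CommAlgCat.of k (R[T;T⁻¹]) :=
  CommAlgCat.ofHom (IsScalarTower.toAlgHom k R (R[T;T⁻¹]))

variable (k) in
/-- `k[λ, λ⁻¹] → R[λ, λ⁻¹]` -/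
def baseLaurent (R : CommAlgCat.{u} k) :
    CommAlgCat.of k (k[T;T⁻¹]) ⟶ CommAlgCat.of k (R[T;T⁻¹]) :=
  CommAlgCat.ofHom (AddMonoidAlgebra.mapAlgHom ℤ (Algebra.ofId k R))

/-- The point `x` is the fibre at `λ = 1` of a family `y` over the affine line which is trivial to
order `c` at `λ = 0`. Away from `λ = 0` the family is the conjugate of `x` by a family `z` which
does not depend on `x`, so that the degree of `y` in `λ` is bounded independently of `x`. For large
`c`, this forces `y` to act trivially. -/
lemma app_eq_one_of_family {D c : ℕ} (hc : D + D < c) {z : H.obj (CommAlgCat.of k (k[T;T⁻¹]))}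
    (hz : ∀ i j, LaurentDegreeLE D (repMatrix ρ b _ z i j))
    (hz' : ∀ i j, LaurentDegreeLE D (repMatrix ρ b _ z⁻¹ i j))
    {R : CommAlgCat.{u} k} {x : H.obj R} {y : H.obj (CommAlgCat.of k (Polynomial R))}
    (h0 : H.map (modPow k R c) y = 1) (h1 : H.map (evalOne k R) y = x)
    (h2 : H.map (toLaurent k R) y * H.map (baseLaurent k R) z =
      H.map (baseLaurent k R) z * H.map (constLaurent k R) x) : (ρ.app R).hom x = 1 := by
  have hY : repMatrix ρ b _ y = 1 := by
    refine matrix_eq_one_of_laurentDegreeLE hc _ ?_ ?_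
    · have := congrArg (repMatrix ρ b _) h0
      rwa [repMatrix_map, map_one] at this
    · have h3 : H.map (toLaurent k R) y =
          H.map (baseLaurent k R) z * H.map (constLaurent k R) x * H.map (baseLaurent k R) z⁻¹ := by
        rw [← h2, mul_assoc, ← map_mul, mul_inv_cancel, map_one, mul_one]
      have h4 := congrArg (repMatrix ρ b _) h3
      rw [map_mul, map_mul, repMatrix_map, repMatrix_map, repMatrix_map, repMatrix_map] at h4
      intro i j
      have h5 : Polynomial.toLaurent (repMatrix ρ b _ y i j) = _ := congrFun (congrFun h4 i) j
      rw [h5]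
      have hbase : ∀ p : k[T;T⁻¹], LaurentDegreeLE D p →
          LaurentDegreeLE D ((baseLaurent k R).hom p : R[T;T⁻¹]) := by
        intro p hp e he
        change (AddMonoidAlgebra.mapAlgHom ℤ (Algebra.ofId k R) p).coeff e = 0
        rw [AddMonoidAlgebra.coeff_mapAlgHom, hp e he, map_zero]
      have h6 := LaurentDegreeLE.matrix_mul (R := R) (D := D + 0) (E := D)
        (LaurentDegreeLE.matrix_mul (R := R) (D := D) (E := 0)
          (M := (repMatrix ρ b _ z).map (baseLaurent k R).hom)
          (N := (repMatrix ρ b _ x).map (constLaurent k R).hom)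
          (fun i j => hbase _ (hz i j)) (fun i j => laurentDegreeLE_algebraMap _))
        (N := (repMatrix ρ b _ z⁻¹).map (baseLaurent k R).hom)
        (fun i j => hbase _ (hz' i j)) i j
      exact h6
  apply app_eq_one_of_repMatrix ρ b
  rw [← h1, repMatrix_map, hY, Matrix.map_one _ (map_zero _) (map_one _)]

end

/-! ### Polynomial automorphisms and surjectivity on jets -/

section
variable {n c : ℕ} {S : Type u} [CommRing S]

/-- Automorphisms of the formal disc given by polynomials are of étale type. -/
lemma mem_etaleAut_of_polynomial (ρ : originAut n S)
    (q : Matrix (Fin n) (Fin n) (MvPolynomial (Fin n) S))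
    (h : ∀ i, ρ.1 (MvPowerSeries.X i) =
      ((∑ j, q i j * MvPolynomial.X j : MvPolynomial (Fin n) S) : Ser n S))
    (hq : IsUnit (q.map MvPolynomial.constantCoeff).det) : ρ ∈ etaleAut n S := by
  refine mem_etaleAut_of_etale (RingHom.id _) (RingHom.Etale.containsIdentities _)
    MvPolynomial.constantCoeff q hq ρ fun c =>
    ⟨Ideal.Quotient.mk _, jetAug_comp_mk n c S, rfl, fun i => ?_⟩
  change _ = trunc n c S (ρ.1 (MvPowerSeries.X i))
  rw [h, trunc_coe]
  rfl

lemma constantCoeff_coe (p : MvPolynomial (Fin n) S) :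
    MvPowerSeries.constantCoeff (p : Ser n S) = MvPolynomial.constantCoeff p := by
  rw [← MvPowerSeries.coeff_zero_eq_constantCoeff_apply, MvPolynomial.coeff_coe,
    MvPolynomial.constantCoeff_eq]

lemma constantCoeff_serSubst (s : Fin n → Ser n S)
    (hs : ∀ k, MvPowerSeries.constantCoeff (s k) = 0) (p : Ser n S) :
    MvPowerSeries.constantCoeff (serSubst s hs p) = MvPowerSeries.constantCoeff p := by
  have : (MvPowerSeries.constantCoeff).comp (serSubst s hs : Ser n S →+* Ser n S) =
      MvPowerSeries.constantCoeff :=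
    ser_hom_ext ⊥ 1 (by simp) _ _
      (fun r => congrArg (fun q : Ser n S => MvPowerSeries.constantCoeff q)
        ((serSubst s hs).commutes r))
      (fun k => by simp [hs]) (fun k => by simp [hs])
  exact DFunLike.congr_fun this p

lemma trunc_serSubst (s : Fin n → Ser n S) (hs : ∀ k, MvPowerSeries.constantCoeff (s k) = 0)
    (σ : originJetAut n c S) (h : ∀ k, trunc n c S (s k) = σ.1 (jetX n c S k)) (p : Ser n S) :
    trunc n c S (serSubst s hs p) = σ.1 (trunc n c S p) := by
  have : (trunc n c S).comp (serSubst s hs : Ser n S →+* Ser n S) =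
      (σ.1 : Jet n c S →+* Jet n c S).comp (trunc n c S) :=
    ser_hom_ext _ _ jet_ker_pow _ _
      (fun r => by
        rw [RingHom.comp_apply, RingHom.comp_apply, trunc_C]
        refine Eq.trans ?_ (σ.1.commutes r).symm
        rw [← trunc_C]
        exact congrArg (trunc n c S) ((serSubst s hs).commutes r))
      (fun k => by simp [h])
      (fun k => by simp [RingHom.mem_ker, jetAug_trunc, hs])
  exact DFunLike.congr_fun this p

lemma exists_polynomial_lift (σ : originJetAut n c S) :
    ∃ q : Matrix (Fin n) (Fin n) (MvPolynomial (Fin n) S), ∀ i,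
      Ideal.Quotient.mk _ (∑ j, q i j * MvPolynomial.X j) = σ.1 (jetX n c S i) := by
  have : ∀ i, ∃ a : Fin n → MvPolynomial (Fin n) S,
      Ideal.Quotient.mk _ (∑ j, a j * MvPolynomial.X j) = σ.1 (jetX n c S i) := by
    intro i
    obtain ⟨p, hp⟩ := Ideal.Quotient.mk_surjective (σ.1 (jetX n c S i))
    have h0 : MvPolynomial.constantCoeff p = 0 := by
      rw [← jetAug_comp_mk n c S]
      change jetAug n c S (Ideal.Quotient.mk _ p) = 0
      rw [hp]
      exact σ.2 i
    have h1 : p ∈ MvPolynomial.idealOfVars (Fin n) S := by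
      rw [← pow_one (MvPolynomial.idealOfVars (Fin n) S), MvPolynomial.mem_pow_idealOfVars_iff']
      intro d hd
      obtain rfl : d = 0 := by simpa [Finsupp.degree_eq_zero_iff] using hd
      exact h0
    obtain ⟨a, ha⟩ := Ideal.mem_span_range_iff_exists_fun.1 h1
    exact ⟨a, by rw [ha, hp]⟩
  choose q hq using this
  exact ⟨q, hq⟩

/-- Every jet of an automorphism is the jet of an automorphism of étale type: lift it to
polynomials. -/
lemma exists_etaleAut_jetOfAut_eq (hc : 1 ≤ c) (σ : originJetAut n c S) :
    ∃ ρ ∈ etaleAut n S, jetOfAut n c S ρ = σ := by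
  classical
  -- the power series given by a polynomial lift of a jet
  let P (q : Matrix (Fin n) (Fin n) (MvPolynomial (Fin n) S)) (i : Fin n) : Ser n S :=
    ((∑ j, q i j * MvPolynomial.X j : MvPolynomial (Fin n) S) : Ser n S)
  have hP0 : ∀ q i, MvPowerSeries.constantCoeff (P q i) = 0 := fun q i => by
    simp [P, constantCoeff_coe]
  have hPX : ∀ q i, P q i = ∑ j, (q i j : Ser n S) * MvPowerSeries.X j := fun q i => by
    change MvPolynomial.coeToMvPowerSeries.ringHom _ = _
    simp
  let α q := serSubst (P q) (hP0 q)
  obtain ⟨q, hq⟩ := exists_polynomial_lift σ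
  obtain ⟨q', hq'⟩ := exists_polynomial_lift σ⁻¹
  have hα : ∀ p, trunc n c S (α q p) = σ.1 (trunc n c S p) :=
    trunc_serSubst _ _ σ (fun k => by rw [← hq, trunc_coe])
  have hα' : ∀ p, trunc n c S (α q' p) = σ⁻¹.1 (trunc n c S p) :=
    trunc_serSubst _ _ σ⁻¹ (fun k => by rw [← hq', trunc_coe])
  have hσ : ∀ x, σ.1 (σ⁻¹.1 x) = x := fun x =>
    congrArg (fun τ : originJetAut n c S => τ.1 x) (mul_inv_cancel σ)
  have hσ' : ∀ x, σ⁻¹.1 (σ.1 x) = x := fun x =>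
    congrArg (fun τ : originJetAut n c S => τ.1 x) (inv_mul_cancel σ)
  have hmem : ∀ p : Ser n S, trunc n c S p = 0 → p ∈ serIdeal n S ^ 2 := fun p hp =>
    Ideal.pow_le_pow_right (by omega) (trunc_eq_zero_iff_mem.1 hp)
  have h1 : ∀ k, α q (α q' (MvPowerSeries.X k)) - MvPowerSeries.X k ∈ serIdeal n S ^ 2 :=
    fun k => hmem _ (by rw [map_sub, hα, hα', hσ, sub_self])
  have h2 : ∀ k, α q' (α q (MvPowerSeries.X k)) - MvPowerSeries.X k ∈ serIdeal n S ^ 2 :=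
    fun k => hmem _ (by rw [map_sub, hα', hα, hσ', sub_self])
  have hb1 := bijective_of_sub_mem ((α q).comp (α q')) h1
  have hb2 := bijective_of_sub_mem ((α q').comp (α q)) h2
  have hb : Function.Bijective (α q) :=
    ⟨Function.Injective.of_comp (f := α q') hb2.1, Function.Surjective.of_comp (g := α q') hb1.2⟩
  obtain ⟨ρ, hρ⟩ := exists_originAut_of_bijective (α q) hb
    (fun k => by simpa [α] using hP0 q k)
  have hρX : ∀ k, ρ.1 (MvPowerSeries.X k) = P q k := fun k => by
    rw [hρ]; exact serSubst_X _ _ k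
  refine ⟨ρ, mem_etaleAut_of_polynomial ρ q hρX ?_, originJetAut_ext fun k => ?_⟩
  · -- the linear parts of the lifts of `σ` and of `σ⁻¹` are inverse to each other
    have hmul : q'.map MvPolynomial.constantCoeff * q.map MvPolynomial.constantCoeff = 1 := by
      ext i l
      have e1 := mem_serIdeal_pow_iff.1 (h1 i) (Finsupp.single l 1) (by simp)
      have e2 : α q (α q' (MvPowerSeries.X i)) =
          ∑ m, (∑ j, α q (q' i j : Ser n S) * (q j m : Ser n S)) * MvPowerSeries.X m := by
        have e3 : ∀ j, α q (MvPowerSeries.X j) = ∑ m, (q j m : Ser n S) * MvPowerSeries.X m :=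
          fun j => (serSubst_X _ _ j).trans (hPX q j)
        have e4 : α q' (MvPowerSeries.X i) = ∑ j, (q' i j : Ser n S) * MvPowerSeries.X j :=
          (serSubst_X _ _ i).trans (hPX q' i)
        rw [e4, map_sum]
        simp only [map_mul, e3, Finset.mul_sum, Finset.sum_mul]
        rw [Finset.sum_comm]
        simp only [mul_assoc]
      rw [map_sub, sub_eq_zero, e2, coeff_single_sum_mul_X, MvPowerSeries.coeff_X] at e1
      simp only [map_sum, map_mul, α, constantCoeff_serSubst, constantCoeff_coe] at e1
      rw [Matrix.mul_apply, Matrix.one_apply]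
      simp only [Matrix.map_apply, e1, Finsupp.single_left_inj one_ne_zero, eq_comm]
    exact Matrix.isUnit_det_of_left_inverse hmul
  · rw [jetOfAut_X, hρX, ← hq, trunc_coe]

lemma sub_X_mem_of_jetOfAut_eq_one {ρ : originAut n S} (h : jetOfAut n c S ρ = 1) (i : Fin n) :
    ρ.1 (MvPowerSeries.X i) - MvPowerSeries.X i ∈ serIdeal n S ^ (c + 1) := by
  rw [← trunc_eq_zero_iff_mem, map_sub, ← jetOfAut_X, h, trunc_X]
  exact sub_self _

/-! ### Dilations -/

/-- The scaling of the coordinates by a unit, an automorphism of étale type. -/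
lemma exists_scaling {u v : S} (huv : u * v = 1) : ∃ z ∈ etaleAut n S,
    ∀ i, z.1 (MvPowerSeries.X i) = MvPowerSeries.C u * MvPowerSeries.X i := by
  classical
  have key : ∀ a : S, ∀ i : Fin n,
      MvPowerSeries.constantCoeff (MvPowerSeries.C a * MvPowerSeries.X i) = 0 := fun a i => by simp
  have hcomp : ∀ a b : S, a * b = 1 →
      (serSubst _ (key a)).comp (serSubst _ (key b)) = AlgHom.id S _ := fun a b hab => by
    have hC : ∀ a r : S, serSubst _ (key a) (MvPowerSeries.C r) = MvPowerSeries.C r :=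
      fun a r => (serSubst _ (key a)).commutes r
    have : ((serSubst _ (key a)).comp (serSubst _ (key b))).toRingHom = RingHom.id _ :=
      ser_hom_ext' _ _
        (fun r => by
          change serSubst _ (key a) (serSubst _ (key b) (MvPowerSeries.C r)) = MvPowerSeries.C r
          rw [hC, hC])
        (fun k => by
          change serSubst _ (key a) (serSubst _ (key b) (MvPowerSeries.X k)) = MvPowerSeries.X k
          rw [serSubst_X, map_mul, hC, serSubst_X, ← mul_assoc, ← map_mul, mul_comm b a, hab,
            map_one, one_mul])
        (fun k => by
          change MvPowerSeries.constantCoeff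
            (serSubst _ (key a) (serSubst _ (key b) (MvPowerSeries.X k))) = 0
          rw [constantCoeff_serSubst, serSubst_X, key])
    ext1 p
    exact DFunLike.congr_fun this p
  let z : originAut n S := ⟨AlgEquiv.ofAlgHom (serSubst _ (key u)) (serSubst _ (key v))
    (hcomp u v huv) (hcomp v u (by rwa [mul_comm])), fun k => by simp⟩
  have hz : ∀ i, z.1 (MvPowerSeries.X i) = MvPowerSeries.C u * MvPowerSeries.X i :=
    fun i => serSubst_X _ (key u) i
  refine ⟨z, mem_etaleAut_of_polynomial z (Matrix.diagonal fun _ => MvPolynomial.C u) ?_ ?_, hz⟩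
  · intro i
    rw [hz, Finset.sum_eq_single i]
    · simp
    · intro j _ hj
      rw [Matrix.diagonal_apply_ne' _ hj, zero_mul]
    · simp
  · rw [Matrix.diagonal_map (map_zero _), Matrix.det_diagonal]
    simp only [MvPolynomial.constantCoeff_C]
    rw [Finset.prod_const]
    exact (IsUnit.of_mul_eq_one v huv).pow _

lemma apply_eq_rescale {z : originAut n S} {u : S}
    (hz : ∀ i, z.1 (MvPowerSeries.X i) = MvPowerSeries.C u * MvPowerSeries.X i) (p : Ser n S) :
    z.1 p = MvPowerSeries.rescale (fun _ => u) p := by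
  classical
  have : (z.1 : Ser n S →+* Ser n S) = MvPowerSeries.rescale (fun _ => u) :=
    ser_hom_ext' _ _
      (fun r => by
        refine (ρ_C z r).trans ?_
        rw [← MvPowerSeries.rescaleAlgHom_apply]
        exact ((MvPowerSeries.rescaleAlgHom (fun _ : Fin n => u)).commutes r).symm)
      (fun k => by
        refine (hz k).trans ?_
        ext1 d
        rw [coeff_rescale_const, MvPowerSeries.coeff_C_mul, MvPowerSeries.coeff_X]
        split_ifs with h
        · simp [h]
        · simp)
      (fun k => z.2 k)
  exact DFunLike.congr_fun this p

lemma IsDilation.map_modPow {ρ : originAut n S} {y : originAut n (Polynomial S)}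
    (h : IsDilation ρ y) (hc : 1 ≤ c) (hρ : jetOfAut n c S ρ = 1) :
    originAutMap n (Ideal.Quotient.mk (Ideal.span {(Polynomial.X : Polynomial S) ^ c})) y = 1 := by
  classical
  refine originAut_ext fun i => ?_
  rw [originAutMap_X, ← sub_eq_zero]
  change MvPowerSeries.map _ _ - MvPowerSeries.X i = 0
  rw [← MvPowerSeries.map_X (Ideal.Quotient.mk _), ← map_sub]
  ext1 d
  rw [MvPowerSeries.coeff_map, map_zero, Ideal.Quotient.eq_zero_iff_mem,
    Ideal.mem_span_singleton, map_sub]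
  by_cases hd : d = 0
  · subst hd
    rw [MvPowerSeries.coeff_zero_eq_constantCoeff_apply, y.2 i]
    simp
  rw [h.coeff_eq i hd]
  by_cases hdc : d.degree < c + 1
  · have h1 := mem_serIdeal_pow_iff.1 (sub_X_mem_of_jetOfAut_eq_one hρ i) d hdc
    rw [map_sub, sub_eq_zero] at h1
    rw [h1, MvPowerSeries.coeff_X, MvPowerSeries.coeff_X]
    split_ifs with h2
    · simp [h2]
    · simp
  · rw [MvPowerSeries.coeff_X, if_neg, sub_zero]
    · exact Dvd.dvd.mul_right (pow_dvd_pow _ (by omega)) _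
    · rintro rfl
      rw [Finsupp.degree_single] at hdc
      omega

lemma IsDilation.map_evalOne {ρ : originAut n S} {y : originAut n (Polynomial S)}
    (h : IsDilation ρ y) (f : Polynomial S →+* S) (hfX : f Polynomial.X = 1)
    (hfC : ∀ s, f (Polynomial.C s) = s) : originAutMap n f y = ρ := by
  refine originAut_ext fun i => ?_
  rw [originAutMap_X]
  ext1 d
  rw [MvPowerSeries.coeff_map]
  by_cases hd : d = 0
  · subst hd
    rw [MvPowerSeries.coeff_zero_eq_constantCoeff_apply, y.2 i,
      MvPowerSeries.coeff_zero_eq_constantCoeff_apply, ρ.2 i, map_zero]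
  · rw [h.coeff_eq i hd, map_mul, map_pow, hfX, one_pow, one_mul, hfC]

/-- Where `λ` is invertible, the dilation is the conjugate of `ρ` by the scaling by `λ`. -/
lemma IsDilation.map_mul_scaling {T : Type u} [CommRing T] {ρ : originAut n S}
    {y : originAut n (Polynomial S)} (h : IsDilation ρ y) (f : Polynomial S →+* T)
    {z : originAut n T} (hz : ∀ i, z.1 (MvPowerSeries.X i) =
      MvPowerSeries.C (f Polynomial.X) * MvPowerSeries.X i) :
    originAutMap n f y * z = z * originAutMap n (f.comp Polynomial.C) ρ := by
  refine originAut_ext fun i => ?_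
  change (originAutMap n f y).1 (z.1 _) = z.1 ((originAutMap n (f.comp Polynomial.C) ρ).1 _)
  rw [hz, map_mul, ρ_C, originAutMap_X, originAutMap_X, apply_eq_rescale hz,
    ← MvPowerSeries.map_C, ← map_mul, h i]
  ext1 d
  simp only [MvPowerSeries.coeff_map, coeff_rescale_const, map_mul, map_pow, RingHom.comp_apply]

end

/-! ### Factorization through jets -/

section
variable {k : Type u} [Field k] {n : ℕ} {V : Type u} [AddCommGroup V] [Module k V]

/-- There is a bound on the order of contact with the identity, beyond which automorphisms of the
formal disc act trivially. It depends only on the action of the scaling automorphism over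
`k[λ, λ⁻¹]`, and hence applies to a representation of `K^et` and to its extensions alike. -/
lemma exists_order_bound [FiniteDimensional k V] (ρ : Representation (Ket k n) V) :
    ∃ c, 1 ≤ c ∧
      (∀ (R : CommAlgCat.{u} k) (x : (Ket k n).obj R),
        (KToKc k n c).app R ((KetToK k n).app R x) = 1 → (ρ.app R).hom x = 1) ∧
      ∀ ρbar : Representation (K k n) V, KetToK k n ≫ ρbar = ρ →
        ∀ (R : CommAlgCat.{u} k) (x : (K k n).obj R),
          (KToKc k n c).app R x = 1 → (ρbar.app R).hom x = 1 := by
  let b := Module.finBasis k V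
  obtain ⟨z, hz, hzX⟩ := exists_scaling (n := n)
    (show (LaurentPolynomial.T 1 : k[T;T⁻¹]) * LaurentPolynomial.T (-1) = 1 by
      rw [← LaurentPolynomial.T_add, add_neg_cancel, LaurentPolynomial.T_zero])
  let zE : (Ket k n).obj (CommAlgCat.of k (k[T;T⁻¹])) := (⟨z, hz⟩ : etaleAut n (k[T;T⁻¹]))
  obtain ⟨D, hD⟩ := exists_forall_laurentDegreeLE
    (fun p : (Fin (Module.finrank k V) × Fin (Module.finrank k V)) ⊕
        (Fin (Module.finrank k V) × Fin (Module.finrank k V)) =>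
      (p.elim (fun p => repMatrix ρ b _ zE p.1 p.2) fun p => repMatrix ρ b _ zE⁻¹ p.1 p.2 :
        k[T;T⁻¹]))
  have hzR : ∀ (R : CommAlgCat.{u} k) (i : Fin n),
      (originAutMap n (baseLaurent k R).hom.toRingHom z).1 (MvPowerSeries.X i) =
        MvPowerSeries.C ((toLaurent k R).hom.toRingHom Polynomial.X) * MvPowerSeries.X i := by
    intro R i
    rw [originAutMap_X, hzX, map_mul, MvPowerSeries.map_C, MvPowerSeries.map_X]
    congr 2
    have h1 : (toLaurent k R).hom.toRingHom Polynomial.X = (LaurentPolynomial.T 1 : R[T;T⁻¹]) :=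
      Polynomial.toLaurent_X
    rw [h1]
    exact (AddMonoidAlgebra.mapAlgHom_single (Algebra.ofId k R) (1 : ℤ) (1 : k)).trans
      (by rw [map_one]; rfl)
  have hconst : ∀ R : CommAlgCat.{u} k, (toLaurent k R).hom.toRingHom.comp Polynomial.C =
      (constLaurent k R).hom.toRingHom := fun R => RingHom.ext fun r => Polynomial.toLaurent_C r
  refine ⟨D + D + 1, by omega, ?_, ?_⟩
  · intro R x hx
    refine app_eq_one_of_locally ρ fun p => ?_
    have h2 : ∀ i, x.1.1 (MvPowerSeries.X i) - MvPowerSeries.X i ∈ serIdeal n R ^ 2 := fun i =>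
      Ideal.pow_le_pow_right (by omega) (sub_X_mem_of_jetOfAut_eq_one hx i)
    obtain ⟨f, hf, y, hy, hd⟩ := exists_isDilation_mem_etaleAut x.2 h2 p
    refine ⟨f, hf, ?_⟩
    have hx' : jetOfAut n (D + D + 1) (Localization.Away f)
        (originAutMap n (algebraMap R (Localization.Away f)) x.1) = 1 := by
      rw [← MonoidHom.comp_apply, jetOfAut_originAutMap, MonoidHom.comp_apply]
      exact (congrArg _ hx).trans (map_one _)
    refine app_eq_one_of_family ρ b (D := D) (c := D + D + 1) (by omega) (z := zE)
      (fun i j => hD (.inl (i, j))) (fun i j => hD (.inr (i, j)))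
      (y := (⟨y, hy⟩ : etaleAut n (Polynomial (Localization.Away f)))) ?_ ?_ ?_
    · exact Subtype.ext (hd.map_modPow (by omega) hx')
    · exact Subtype.ext (hd.map_evalOne _ (Polynomial.aeval_X _) (fun s => Polynomial.aeval_C _ s))
    · refine Subtype.ext ((hd.map_mul_scaling
        (toLaurent k (CommAlgCat.of k (Localization.Away f))).hom.toRingHom (hzR _)).trans ?_)
      rw [hconst]
      rfl
  · rintro ρbar rfl R x hx
    have h2 : ∀ i, (x : originAut n R).1 (MvPowerSeries.X i) - MvPowerSeries.X i ∈
        serIdeal n R ^ 2 := fun i =>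
      Ideal.pow_le_pow_right (by omega) (sub_X_mem_of_jetOfAut_eq_one hx i)
    obtain ⟨y, hd⟩ := exists_isDilation _ h2
    refine app_eq_one_of_family ρbar b (D := D) (c := D + D + 1) (by omega)
      (z := (KetToK k n).app _ zE)
      (fun i j => hD (.inl (i, j))) (fun i j => hD (.inr (i, j))) (y := y) ?_ ?_ ?_
    · exact hd.map_modPow (by omega) hx
    · exact hd.map_evalOne _ (Polynomial.aeval_X _) (fun s => Polynomial.aeval_C _ s)
    · refine (hd.map_mul_scaling (toLaurent k R).hom.toRingHom (hzR _)).trans ?_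
      rw [hconst]
      rfl

lemma exists_Ket_lift {c : ℕ} (hc : 1 ≤ c) (R : CommAlgCat.{u} k) (σ : (Kc k n c).obj R) :
    ∃ x : (Ket k n).obj R, (KToKc k n c).app R ((KetToK k n).app R x) = σ := by
  obtain ⟨x, hx, h⟩ := exists_etaleAut_jetOfAut_eq hc (σ : originJetAut n c R)
  exact ⟨(⟨x, hx⟩ : etaleAut n R), h⟩

/-- A representation of `K^et` trivial on the kernels of the surjections `K^et → K^(c)` descends
to `K^(c)`. -/
lemma exists_Kc_representation {c : ℕ} (hc : 1 ≤ c) (ρ : Representation (Ket k n) V)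
    (hρ : ∀ (R : CommAlgCat.{u} k) (x : (Ket k n).obj R),
        (KToKc k n c).app R ((KetToK k n).app R x) = 1 → (ρ.app R).hom x = 1) :
    ∃ ρc : Representation (Kc k n c) V, KetToK k n ≫ KToKc k n c ≫ ρc = ρ := by
  let π : Ket k n ⟶ Kc k n c := KetToK k n ≫ KToKc k n c
  have hsurj : ∀ R, Function.Surjective (π.app R).hom := fun R σ => exists_Ket_lift hc R σ
  have hker : ∀ R, (π.app R).hom.ker ≤ (ρ.app R).hom.ker := fun R x hx => hρ R x hx
  let φ := fun R => (π.app R).hom.liftOfSurjective (hsurj R) ⟨(ρ.app R).hom, hker R⟩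
  have hφ : ∀ R x, φ R ((π.app R).hom x) = (ρ.app R).hom x := fun R x =>
    MonoidHom.liftOfRightInverse_comp_apply _ _ _ ⟨(ρ.app R).hom, hker R⟩ x
  let ρc : Representation (Kc k n c) V :=
    { app := fun R => GrpCat.ofHom (φ R)
      naturality := fun R S f => by
        apply GrpCat.hom_ext
        ext1 σ
        obtain ⟨x, rfl⟩ := hsurj R σ
        have h1 := DFunLike.congr_fun (congrArg GrpCat.Hom.hom (π.naturality f)) x
        have h2 := DFunLike.congr_fun (congrArg GrpCat.Hom.hom (ρ.naturality f)) x
        refine (congrArg (φ S) h1.symm).trans ((hφ S _).trans (h2.trans ?_))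
        exact congrArg ((GLV V).map f).hom (hφ R x).symm }
  refine ⟨ρc, ?_⟩
  apply NatTrans.ext
  funext R
  apply GrpCat.hom_ext
  ext1 x
  exact hφ R x

end

end FormalDisc

end

/-- Let `k` be an algebraically closed field of characteristic zero and `V` a finite-dimensional
`k`-vector space. Every representation `ρ : K^et → GL_V` extends uniquely to a representation of
`K`; moreover, for some `c`, `ρ` factors through the finite-dimensional quotient `K^(c)`, and the
extension is the one defined via `K ↠ K^(c)`. -/
theorem mainTheorem5 {k : Type u} [Field k] [IsAlgClosed k] [CharZero k] (n : ℕ)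
    {V : Type u} [AddCommGroup V] [Module k V] [FiniteDimensional k V]
    (ρ : FormalDisc.Representation (FormalDisc.Ket k n) V) :
    (∃! ρbar : FormalDisc.Representation (FormalDisc.K k n) V, FormalDisc.KetToK k n ≫ ρbar = ρ) ∧
    (∃ (c : ℕ) (ρc : FormalDisc.Representation (FormalDisc.Kc k n c) V),
      FormalDisc.KetToK k n ≫ FormalDisc.KToKc k n c ≫ ρc = ρ ∧
      ∀ ρbar : FormalDisc.Representation (FormalDisc.K k n) V, FormalDisc.KetToK k n ≫ ρbar = ρ →
        ρbar = FormalDisc.KToKc k n c ≫ ρc) := by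
  obtain ⟨c, hc, hker, hkerbar⟩ := FormalDisc.exists_order_bound ρ
  obtain ⟨ρc, hρc⟩ := FormalDisc.exists_Kc_representation hc ρ hker
  have huniq : ∀ ρbar : FormalDisc.Representation (FormalDisc.K k n) V,
      FormalDisc.KetToK k n ≫ ρbar = ρ → ρbar = FormalDisc.KToKc k n c ≫ ρc := by
    intro ρbar hbar
    apply NatTrans.ext
    funext R
    apply GrpCat.hom_ext
    ext1 x
    obtain ⟨e, he⟩ := FormalDisc.exists_Ket_lift hc R ((FormalDisc.KToKc k n c).app R x)
    -- `x` differs from a point of `K^et` by an element on which every extension is trivial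
    have h1 : (ρbar.app R).hom (x * ((FormalDisc.KetToK k n).app R e)⁻¹) = 1 := by
      apply hkerbar ρbar hbar
      rw [map_mul, map_inv, he, mul_inv_cancel]
    rw [map_mul, map_inv, mul_inv_eq_one] at h1
    have h2 : (ρbar.app R).hom ((FormalDisc.KetToK k n).app R e) = (ρ.app R).hom e := by
      rw [← hbar]; rfl
    have h3 : (ρc.app R).hom ((FormalDisc.KToKc k n c).app R ((FormalDisc.KetToK k n).app R e)) =
        (ρ.app R).hom e := by
      rw [← hρc]; rfl
    rw [he] at h3
    exact h1.trans (h2.trans h3.symm)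
  exact ⟨⟨FormalDisc.KToKc k n c ≫ ρc, hρc, huniq⟩, c, ρc, hρc, huniq⟩
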